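/- Let $m=(m_0,m_1,\dots)$ be a bounded sequence of integers $m_k\ge 2$, $M_0:=1$, $M_{k+1}:=m_kM_k$, and let $G_m=\prod_{k\ge 0}\mathbb{Z}_{m_k}$ be the corresponding bounded Vilenkin group, with coordinatewise addition modulo $m_k$; let $\mu$ denote the normalized Haar measure on $G_m$ and also its product on $G_m\times G_m$. Put $I_n(x):=\{y\in G_m: y_j=x_j,\ 0\le j<n\}$, $I_n:=I_n(0)$, and let $e_q\in G_m$ have $q$-th coordinate $1$ and all other coordinates $0$. For $n\in\mathbb{N}=\{0,1,2,\dots\}$, integrable $f:G_m\times G_m\to\mathbb{C}$ and $(x,y)\in G_m\times G_m$ put $$V_n(x,y;f):=\sum_{q=0}^{n-1}\sum_{k=q}^{n-1}\sum_{\tau=1}^{m_q-1}\frac{M_qM_k}{m_k}\left(\int_{I_k(\tau e_q)\times I_k}+\int_{I_k\times I_k(\tau e_q)}\right)f(x-t,y-u)\,\mathbb{I}_{\{t_r+u_r=0\ (\mathrm{mod}\ m_r),\ r=k+1,\dots,n-1\}}(t,u)\,d\mu(t,u)$$ $$\qquad+\sum_{s=0}^{n}\sum_{i=s}^{n}\sum_{\tau=1}^{m_s-1}M_sM_i\left(\int_{I_n\times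 I_i(\tau e_s)}+\int_{I_i(\tau e_s)\times I_n}\right)f(x-t,y-u)\,d\mu(t,u).$$ Let $F_n$ be the $\sigma$-algebra generated by the cubes $I_n(x)\times I_n(y)$, $x,y\in G_m$. For a complex martingale $f=(f^{(n)})_{n\in\mathbb{N}}$ with respect to $(F_n)$ put $V_nf:=V_n f^{(n)}$ (which equals $V_nf^{(k)}$ for every $k\ge n$), $f^*:=\sup_n|f^{(n)}|$ and $\|f\|_{H_p}:=\|f^*\|_p=\left(\int |f^*|^p\,d\mu\right)^{1/p}$; the Hardy space $H_p(G_m\times G_m)$, $0<p<\infty$, consists of the martingales with $\|f\|_{H_p}<\infty$. For a martingale or an integrable function $f$ let $Vf:=\sup_{n\in\mathbb{N}}|V_nf|$. Then for every $1/2<p<\infty$ there is a constant $c_p$, depending only on $p$ and on an upper bound of the sequence $m$, such that $$\|Vf\|_p\le c_p\,\|f\|_{H_p}\qquad (f\in H_p(G_m\times G_m)),$$ and there is a constant $c$, depending only on an upper bound of the sequence $m$, such that $$\sup_{\lambda>0}\lambda\,\mu\{Vf>\lambda\}\le c\,\|f\|_1\qquad (f\in L_1(G_m\times G_m)).$$ 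-/

import Mathlib

open MeasureTheory
open scoped ENNReal NNReal

noncomputable section

namespace Vilenkin

/-- The Vilenkin group `G_m`: the complete direct product of the cyclic groups `Z_{m_k}`,
with coordinatewise addition modulo `m_k` and the product σ-algebra. -/
abbrev G (m : ℕ → ℕ) : Type := ∀ k, ZMod (m k)

/-- `M_0 = 1`, `M_{k+1} = m_k M_k`. -/
def M (m : ℕ → ℕ) (k : ℕ) : ℕ := ∏ i ∈ Finset.range k, m i

/-- The normalized Haar measure of `G_m`: the product of the uniform probability measures on the
coordinates. -/
def haar (m : ℕ → ℕ) : Measure (G m) :=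
  Measure.infinitePi fun k => ProbabilityTheory.uniformOn (Set.univ : Set (ZMod (m k)))

/-- The product measure on `G_m × G_m`. -/
def haar₂ (m : ℕ → ℕ) : Measure (G m × G m) := (haar m).prod (haar m)

/-- `I_n(x)`: the points of `G_m` whose first `n` coordinates are those of `x`. -/
def I {m : ℕ → ℕ} (n : ℕ) (x : G m) : Set (G m) := {y | ∀ j < n, y j = x j}

/-- The cubes `I_n(x) × I_n(y)` of level `n`. -/
def cubes (m : ℕ → ℕ) (n : ℕ) : Set (Set (G m × G m)) :=
  Set.range fun z : G m × G m => I n z.1 ×ˢ I n z.2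

theorem mem_I_self {m : ℕ → ℕ} (n : ℕ) (x : G m) : x ∈ I n x := fun _ _ => rfl

theorem countable_cubes (m : ℕ → ℕ) (n : ℕ) : (cubes m n).Countable := by
  have hc : ∀ a : ℕ, Countable (ZMod a) := fun a => by
    cases a with
    | zero => exact inferInstanceAs (Countable ℤ)
    | succ b => exact inferInstanceAs (Countable (Fin (b + 1)))
  let P := ∀ j : Fin n, ZMod (m j)
  have hP : Countable P := inferInstance
  let g : P × P → Set (G m × G m) := fun w =>
    {y | ∀ j (hj : j < n), y j = w.1 ⟨j, hj⟩} ×ˢ {y | ∀ j (hj : j < n), y j = w.2 ⟨j, hj⟩}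
  refine (Set.countable_range g).mono ?_
  rintro _ ⟨z, rfl⟩
  exact ⟨(fun j => z.1 j, fun j => z.2 j), rfl⟩

theorem measurableSet_I {m : ℕ → ℕ} (n : ℕ) (x : G m) : MeasurableSet (I n x) := by
  have h : I n x = ⋂ j ∈ Set.Iio n, (fun y : G m => y j) ⁻¹' {x j} := by
    ext y
    simp [I]
  rw [h]
  exact MeasurableSet.biInter (Set.to_countable _)
    fun j _ => measurable_pi_apply j (MeasurableSpace.measurableSet_top)

/-- The filtration `(F_n)`: `F_n` is the σ-algebra generated by the cubes of level `n`. -/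
def cubeFiltration (m : ℕ → ℕ) :
    Filtration ℕ (inferInstance : MeasurableSpace (G m × G m)) where
  seq n := MeasurableSpace.generateFrom (cubes m n)
  mono' := by
    intro k l hkl
    refine MeasurableSpace.generateFrom_le ?_
    rintro _ ⟨z, rfl⟩
    have h : (I k z.1 ×ˢ I k z.2 : Set (G m × G m)) =
        ⋃₀ {Q ∈ cubes m l | Q ⊆ I k z.1 ×ˢ I k z.2} := by
      apply Set.Subset.antisymm
      · intro w hw
        refine ⟨I l w.1 ×ˢ I l w.2, ⟨⟨w, rfl⟩, ?_⟩, mem_I_self l _, mem_I_self l _⟩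
        rintro v ⟨hv₁, hv₂⟩
        exact ⟨fun j hj => (hv₁ j (hj.trans_le hkl)).trans (hw.1 j hj),
          fun j hj => (hv₂ j (hj.trans_le hkl)).trans (hw.2 j hj)⟩
      · exact Set.sUnion_subset fun Q hQ => hQ.2
    show MeasurableSet[MeasurableSpace.generateFrom (cubes m l)] (I k z.1 ×ˢ I k z.2)
    rw [h]
    exact @MeasurableSet.sUnion _ (MeasurableSpace.generateFrom (cubes m l)) _
      ((countable_cubes m l).mono fun Q hQ => hQ.1)
      fun Q hQ => MeasurableSpace.measurableSet_generateFrom hQ.1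
  le' := by
    intro n
    refine MeasurableSpace.generateFrom_le ?_
    rintro _ ⟨z, rfl⟩
    exact (measurableSet_I n z.1).prod (measurableSet_I n z.2)

/-- The maximal function `f^* = sup_n |f^{(n)}|` of a sequence of functions. -/
def maximalFunction {m : ℕ → ℕ} (f : ℕ → G m × G m → ℂ) (z : G m × G m) : ℝ≥0∞ :=
  ⨆ n, ‖f n z‖ₑ

/-- The `H_p` (quasi-)norm `‖f‖_{H_p} = ‖f^*‖_p`, for `0 < p < ∞`. -/
def hardyNorm {m : ℕ → ℕ} (p : ℝ) (f : ℕ → G m × G m → ℂ) : ℝ≥0∞ :=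
  eLpNorm (maximalFunction f) (ENNReal.ofReal p) (haar₂ m)

/-- `f ∈ H_p(G_m × G_m)`: `f` is a martingale with respect to `(F_n)` and `‖f‖_{H_p} < ∞`. -/
def MemHardy {m : ℕ → ℕ} (p : ℝ) (f : ℕ → G m × G m → ℂ) : Prop :=
  Martingale f (cubeFiltration m) (haar₂ m) ∧ hardyNorm p f < ∞

/-- The set of `(t, u)` such that `t_r + u_r = 0 (mod m_r)` for `r = a, ..., b - 1`. -/
def antiDiag (m : ℕ → ℕ) (a b : ℕ) : Set (G m × G m) :=
  {z | ∀ r, a ≤ r → r < b → z.1 r + z.2 r = 0}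

/-- `V_n^{(1)}(x, y; f)`; here `Pi.single q τ` is the group element `τ e_q`. -/
def V₁ {m : ℕ → ℕ} (n : ℕ) (f : G m × G m → ℂ) (z : G m × G m) : ℂ :=
  ∑ q ∈ Finset.range n, ∑ k ∈ Finset.Ico q n, ∑ τ ∈ Finset.Ico 1 (m q),
    ((M m q : ℂ) * (M m k : ℂ) / (m k : ℂ)) *
      ∫ w in I k (Pi.single q (τ : ZMod (m q))) ×ˢ I k 0,
        f (z.1 - w.1, z.2 - w.2) * (antiDiag m (k + 1) n).indicator 1 w ∂(haar₂ m)

/-- `V_n^{(2)}(x, y; f)`. -/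
def V₂ {m : ℕ → ℕ} (n : ℕ) (f : G m × G m → ℂ) (z : G m × G m) : ℂ :=
  ∑ q ∈ Finset.range n, ∑ k ∈ Finset.Ico q n, ∑ τ ∈ Finset.Ico 1 (m q),
    ((M m q : ℂ) * (M m k : ℂ) / (m k : ℂ)) *
      ∫ w in I k 0 ×ˢ I k (Pi.single q (τ : ZMod (m q))),
        f (z.1 - w.1, z.2 - w.2) * (antiDiag m (k + 1) n).indicator 1 w ∂(haar₂ m)

/-- `V_n^{(3)}(x, y; f)`. -/
def V₃ {m : ℕ → ℕ} (n : ℕ) (f : G m × G m → ℂ) (z : G m × G m) : ℂ :=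
  ∑ s ∈ Finset.range (n + 1), ∑ i ∈ Finset.Icc s n, ∑ τ ∈ Finset.Ico 1 (m s),
    ((M m s : ℂ) * (M m i : ℂ)) *
      ∫ w in I n 0 ×ˢ I i (Pi.single s (τ : ZMod (m s))),
        f (z.1 - w.1, z.2 - w.2) ∂(haar₂ m)

/-- `V_n^{(4)}(x, y; f)`. -/
def V₄ {m : ℕ → ℕ} (n : ℕ) (f : G m × G m → ℂ) (z : G m × G m) : ℂ :=
  ∑ s ∈ Finset.range (n + 1), ∑ i ∈ Finset.Icc s n, ∑ τ ∈ Finset.Ico 1 (m s),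
    ((M m s : ℂ) * (M m i : ℂ)) *
      ∫ w in I i (Pi.single s (τ : ZMod (m s))) ×ˢ I n 0,
        f (z.1 - w.1, z.2 - w.2) ∂(haar₂ m)

/-- `V_n(x, y; f)` for a function `f` on `G_m × G_m`. -/
def Vn {m : ℕ → ℕ} (n : ℕ) (f : G m × G m → ℂ) (z : G m × G m) : ℂ :=
  V₁ n f z + V₂ n f z + V₃ n f z + V₄ n f z

/-- `V f = sup_n |V_n f|` for a function `f` on `G_m × G_m`. -/
def V {m : ℕ → ℕ} (f : G m × G m → ℂ) (z : G m × G m) : ℝ≥0∞ :=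
  ⨆ n, ‖Vn n f z‖ₑ

/-- `V f = sup_n |V_n f|` for a martingale `f = (f^{(0)}, f^{(1)}, ...)`. The operator `V_n` is
the convolution with a kernel that depends only on the first `n` coordinates of `t` and of `u`,
so `V_n f^{(k)} = V_n f^{(n)}` for all `k ≥ n`, and this common value is `V_n f`. -/
def martingaleV {m : ℕ → ℕ} (f : ℕ → G m × G m → ℂ) (z : G m × G m) : ℝ≥0∞ :=
  ⨆ n, ‖Vn n (f n) z‖ₑ

end Vilenkin

end

/-! Convergence comes from splitting `Vn` into pieces and fixing the shape of each piece. In all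
four sums put l = k - q, j = n - k (with s, i in place of q, k in the last two) and keep τ. For a
fixed shape (l, j, τ), taking the supremum over n amounts to taking the supremum over q of averages
over `pieceSet`. The mass of such a piece, coefficient times measure, is about M_q / M_n ≤
2^{-(l+j)}. It therefore suffices to bound each of these maximal operators with a constant growing
only polynomially in l and j.

That bound is `mul_measure_iSup_convAverage_gt_le`: weak type (1,1) with constant 1 + l + j. The
piece is a union of cosets of I_n × I_n inside a single translate, by a vector v_q of I_q × I_q, of
I_k × I_k. Take the stopping sets of the cube averages of g at height a. Discard the stopping sets
themselves, together with the v_q-translates of those at the l levels after q. At a remaining point,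
a large average can only come from the stopping levels between k and n; there are at most j of
these, and they are handled by Chebyshev's inequality. The stopping sets are disjoint, so the total
cost is 1 + l + j times the integral of g. Geometric weights then allow summation over shapes in
weak L^1 (`mul_measure_tsum_gt_le`), which with r = 1 is the weak type inequality for V.

For the Hardy spaces take 1/2 < r ≤ 1 with r < p and estimate |V_n f|^r. Since f^{(n)} is constant
on cubes of level n, the r-th power can be moved inside the integral at the price of the factor
(M_n^2)^{1-r} (`lintegral_rpow_le_of_const_on_cosets`). The coefficients still decay like
2^{(1-2r)(l+j)} (`coefficient_bound`), which is where 1/2 enters. Hence (Vf)^r is dominated by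
`pieceMaximal` applied to (f^*)^r, and `lintegral_rpow_le_of_weakType` gives its boundedness on
L^{p/r}, where p/r > 1. -/

namespace Vilenkin

/-! ### Averages over subsets of a group with invariant probability measure. -/

section Averages

variable {X : Type*} [AddCommGroup X] [MeasurableSpace X]

/-- The average of `w ↦ g (z - w)` over `S`, that is, the convolution of `g` with the normalized
indicator of `S`. -/
noncomputable def convAverage (μ : Measure X) (S : Set X) (g : X → ℝ≥0∞) (z : X) : ℝ≥0∞ :=
  (μ S)⁻¹ * ∫⁻ w in S, g (z - w) ∂μ

variable {μ : Measure X} {S : Set X} {g h : X → ℝ≥0∞}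

theorem convAverage_le_of_forall_le {a : ℝ≥0∞} (hg : ∀ z, g z ≤ a) (z : X) :
    convAverage μ S g z ≤ a := by
  have h1 : ∫⁻ w in S, g (z - w) ∂μ ≤ a * μ S := by
    rw [← setLIntegral_const]
    exact lintegral_mono fun w => hg _
  calc convAverage μ S g z ≤ (μ S)⁻¹ * (a * μ S) := by unfold convAverage; gcongr
    _ = a * ((μ S)⁻¹ * μ S) := by ring
    _ ≤ a * 1 := by gcongr; exact ENNReal.inv_mul_le_one _
    _ = a := mul_one a

/-- A set invariant under U is a union of cosets, and the average at z sees only the coset of z, so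
cutting off to D commutes with averaging. -/
theorem convAverage_indicator {U : AddSubgroup X} (hU : MeasurableSet (U : Set X)) {D : Set X}
    (hD : ∀ z, ∀ v ∈ U, z - v ∈ D ↔ z ∈ D) (z : X) :
    convAverage μ U (D.indicator g) z = D.indicator (convAverage μ U g) z := by
  by_cases hz : z ∈ D
  · rw [Set.indicator_of_mem hz]
    unfold convAverage
    congr 1
    refine setLIntegral_congr_fun hU fun w hw => ?_
    exact Set.indicator_of_mem ((hD z w hw).2 hz) _
  · rw [Set.indicator_of_notMem hz]
    unfold convAverage
    rw [setLIntegral_congr_fun (g := fun _ => 0) hU fun w hw =>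
      Set.indicator_of_notMem (fun h => hz ((hD z w hw).1 h)) _]
    simp

variable [MeasurableAdd₂ X]

/-- Averages over a subgroup are invariant under translations by the subgroup. -/
theorem convAverage_sub_of_mem [μ.IsAddLeftInvariant] {U : AddSubgroup X}
    (hU : MeasurableSet (U : Set X)) {v : X} (hv : v ∈ U) (z : X) :
    convAverage μ U g (z - v) = convAverage μ U g z := by
  unfold convAverage
  congr 1
  rw [← lintegral_indicator hU, ← lintegral_indicator hU,
    ← lintegral_add_left_eq_self ((U : Set X).indicator fun w => g (z - w)) v]
  refine lintegral_congr fun w => ?_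
  by_cases hw : w ∈ U
  · have hvw : v + w ∈ U := U.add_mem hv hw
    simp only [Set.indicator, SetLike.mem_coe, hw, hvw, if_true, sub_sub]
  · have hvw : v + w ∉ U := by rwa [U.add_mem_cancel_left hv]
    simp only [Set.indicator, SetLike.mem_coe, hw, hvw, if_false]

variable [MeasurableNeg X]

theorem measurable_comp_const_sub (hg : Measurable g) (z : X) : Measurable fun w => g (z - w) :=
  hg.comp (measurable_id.const_sub z)

theorem convAverage_add (hg : Measurable g) (z : X) :
    convAverage μ S (fun z => g z + h z) z = convAverage μ S g z + convAverage μ S h z := by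
  unfold convAverage
  rw [lintegral_add_left (measurable_comp_const_sub hg z), mul_add]

variable [IsProbabilityMeasure μ]

theorem measurable_convAverage (S : Set X) (hg : Measurable g) :
    Measurable (convAverage μ S g) := by
  unfold convAverage
  refine Measurable.const_mul ?_ _
  exact Measurable.lintegral_prod_right' (f := fun p : X × X => g (p.1 - p.2))
    (hg.comp (measurable_fst.sub measurable_snd))

variable [μ.IsAddLeftInvariant]

/-- Tonelli and translation invariance. It is only an inequality because S may be null, in which
case the average is 0. -/
theorem lintegral_convAverage_le (S : Set X) (hg : Measurable g) :
    ∫⁻ z, convAverage μ S g z ∂μ ≤ ∫⁻ z, g z ∂μ := by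
  have hm : Measurable (Function.uncurry fun z w : X => g (z - w)) :=
    hg.comp (measurable_fst.sub measurable_snd)
  have h1 : ∫⁻ z, convAverage μ S g z ∂μ = (μ S)⁻¹ * ((∫⁻ z, g z ∂μ) * μ S) := by
    unfold convAverage
    rw [lintegral_const_mul (f := fun z => ∫⁻ w in S, g (z - w) ∂μ) _ hm.lintegral_prod_right',
      lintegral_lintegral_swap hm.aemeasurable]
    simp_rw [lintegral_sub_right_eq_self g]
    rw [setLIntegral_const]
  rw [h1]
  calc (μ S)⁻¹ * ((∫⁻ z, g z ∂μ) * μ S) = (∫⁻ z, g z ∂μ) * ((μ S)⁻¹ * μ S) := by ring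
    _ ≤ (∫⁻ z, g z ∂μ) * 1 := by gcongr; exact ENNReal.inv_mul_le_one _
    _ = ∫⁻ z, g z ∂μ := mul_one _

theorem mul_measure_convAverage_gt_le (S : Set X) (hg : Measurable g) (a : ℝ≥0∞) :
    a * μ {z | a < convAverage μ S g z} ≤ ∫⁻ z, g z ∂μ :=
  calc a * μ {z | a < convAverage μ S g z} ≤ a * μ {z | a ≤ convAverage μ S g z} := by
        gcongr with z
        exact le_of_lt
    _ ≤ ∫⁻ z, convAverage μ S g z ∂μ :=
        mul_meas_ge_le_lintegral (measurable_convAverage S hg) a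
    _ ≤ _ := lintegral_convAverage_le S hg

variable {U : AddSubgroup X}

theorem setLIntegral_convAverage_le (hU : MeasurableSet (U : Set X)) {D : Set X}
    (hDm : MeasurableSet D) (hD : ∀ z, ∀ v ∈ U, z - v ∈ D ↔ z ∈ D) (hg : Measurable g) :
    ∫⁻ z in D, convAverage μ U g z ∂μ ≤ ∫⁻ z in D, g z ∂μ := by
  rw [← lintegral_indicator hDm, ← lintegral_indicator hDm]
  calc ∫⁻ z, D.indicator (convAverage μ U g) z ∂μ
      = ∫⁻ z, convAverage μ U (D.indicator g) z ∂μ :=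
        lintegral_congr fun z => (convAverage_indicator hU hD z).symm
    _ ≤ _ := lintegral_convAverage_le _ (hg.indicator hDm)

/-- Averaging over a subgroup does not change the averages over a union of its cosets. -/
theorem convAverage_convAverage (hU : MeasurableSet (U : Set X)) (hU0 : μ U ≠ 0)
    (hS : MeasurableSet S) (hSU : ∀ w ∈ S, ∀ v ∈ U, w + v ∈ S) (hg : Measurable g) (z : X) :
    convAverage μ S (convAverage μ U g) z = convAverage μ S g z := by
  unfold convAverage
  congr 1
  have hm : Measurable (Function.uncurry fun w v : X => g (z - w - v)) :=
    hg.comp ((measurable_const.sub measurable_fst).sub measurable_snd)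
  rw [lintegral_const_mul (f := fun w => ∫⁻ v in U, g (z - w - v) ∂μ) _ hm.lintegral_prod_right',
    lintegral_lintegral_swap hm.aemeasurable]
  have key : ∀ v ∈ U, ∫⁻ w in S, g (z - w - v) ∂μ = ∫⁻ w in S, g (z - w) ∂μ := by
    intro v hv
    rw [← lintegral_indicator hS, ← lintegral_indicator hS,
      ← lintegral_add_left_eq_self (S.indicator fun w => g (z - w)) v]
    refine lintegral_congr fun w => ?_
    have hiff : v + w ∈ S ↔ w ∈ S := by
      refine ⟨fun h => ?_, fun h => add_comm w v ▸ hSU w h v hv⟩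
      have := hSU _ h (-v) (U.neg_mem hv)
      rwa [add_neg_cancel_comm] at this
    by_cases hw : w ∈ S
    · simp only [Set.indicator, hw, hiff.2 hw, if_true]
      congr 1
      abel
    · simp only [Set.indicator, hw, mt hiff.1 hw, if_false]
  rw [setLIntegral_congr_fun hU key, setLIntegral_const, mul_comm, mul_assoc,
    ENNReal.mul_inv_cancel hU0 (measure_ne_top μ _), mul_one]

end Averages

/-! ### Stopping sets and the weak type (1,1) inequality for shifted averages. -/

section WeakType

variable {X : Type*} [AddCommGroup X] [MeasurableSpace X]

/-- The points at which the averages of `g` over the subgroups `U 0, U 1, …` exceed `a` for the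
first time at level `N`. -/
def firstExceed (μ : Measure X) (U : ℕ → AddSubgroup X) (g : X → ℝ≥0∞) (a : ℝ≥0∞) (N : ℕ) :
    Set X :=
  {z | a < convAverage μ (U N) g z ∧ ∀ i < N, convAverage μ (U i) g z ≤ a}

variable {μ : Measure X} {U : ℕ → AddSubgroup X} {g : X → ℝ≥0∞} {a : ℝ≥0∞}

theorem pairwise_disjoint_firstExceed :
    Pairwise (Function.onFun Disjoint (firstExceed μ U g a)) := by
  intro i j hij
  refine Set.disjoint_left.2 fun z hi hj => ?_
  rcases lt_or_gt_of_ne hij with h | h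
  · exact absurd hi.1 (not_lt.2 (hj.2 i h))
  · exact absurd hj.1 (not_lt.2 (hi.2 j h))

/-- The averages over two consecutive subgroups compare, if the index is bounded. -/
theorem convAverage_succ_le {D : ℝ≥0∞} (hanti : Antitone U) (h0 : ∀ n, μ (U n : Set X) ≠ 0)
    (hfin : ∀ n, μ (U n : Set X) ≠ ∞)
    (hD : ∀ n, μ (U n : Set X) ≤ D * μ (U (n + 1) : Set X)) (n : ℕ) (z : X) :
    convAverage μ (U (n + 1)) g z ≤ D * convAverage μ (U n) g z := by
  unfold convAverage
  rw [← mul_assoc]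
  have h1 : (μ (U (n + 1) : Set X))⁻¹ ≤ D * (μ (U n : Set X))⁻¹ := by
    rw [ENNReal.inv_le_iff_le_mul (fun _ => h0 _) (fun h => absurd h (hfin _))]
    calc (1 : ℝ≥0∞) = μ (U n : Set X) * (μ (U n : Set X))⁻¹ :=
          (ENNReal.mul_inv_cancel (h0 n) (hfin n)).symm
      _ ≤ (D * μ (U (n + 1) : Set X)) * (μ (U n : Set X))⁻¹ := by gcongr; exact hD n
      _ = μ (U (n + 1) : Set X) * (D * (μ (U n : Set X))⁻¹) := by ring
  gcongr
  exact hanti n.le_succ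

variable [MeasurableAdd₂ X]

theorem sub_mem_firstExceed [μ.IsAddLeftInvariant] (hanti : Antitone U)
    (hmeas : ∀ n, MeasurableSet (U n : Set X)) {N : ℕ} {v : X} (hv : v ∈ U N) (z : X) :
    z - v ∈ firstExceed μ U g a N ↔ z ∈ firstExceed μ U g a N := by
  unfold firstExceed
  simp only [Set.mem_ofPred_eq]
  rw [convAverage_sub_of_mem (hmeas N) hv]
  refine and_congr_right fun _ => forall₂_congr fun i hi => ?_
  rw [convAverage_sub_of_mem (hmeas i) (hanti hi.le hv)]

variable [MeasurableNeg X] [IsProbabilityMeasure μ]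

theorem measurableSet_firstExceed (hg : Measurable g) (N : ℕ) :
    MeasurableSet (firstExceed μ U g a N) := by
  have h : firstExceed μ U g a N = {z | a < convAverage μ (U N) g z} ∩
      ⋂ i ∈ Set.Iio N, {z | convAverage μ (U i) g z ≤ a} := by
    ext z
    simp [firstExceed]
  rw [h]
  exact (measurableSet_lt measurable_const (measurable_convAverage _ hg)).inter
    (MeasurableSet.biInter (Set.to_countable _) fun i _ =>
      measurableSet_le (measurable_convAverage _ hg) measurable_const)

/-- The stopping sets are disjoint. The injection φ serves the shifted levels q + i + 1 and q + l +
i, with i fixed and q running. -/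
theorem tsum_setLIntegral_firstExceed_le (hg : Measurable g) {φ : ℕ → ℕ}
    (hφ : Function.Injective φ) :
    ∑' N, ∫⁻ z in firstExceed μ U g a (φ N), g z ∂μ ≤ ∫⁻ z, g z ∂μ := by
  refine (ENNReal.tsum_comp_le_tsum_of_injective hφ
    fun N => ∫⁻ z in firstExceed μ U g a N, g z ∂μ).trans ?_
  rw [← lintegral_iUnion (measurableSet_firstExceed hg) pairwise_disjoint_firstExceed]
  exact setLIntegral_le_lintegral _ _

variable [μ.IsAddLeftInvariant]

/-- On the stopping set the level N average exceeds a. The set is invariant under U N, so replacing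
that average by g does not decrease the integral over it. -/
theorem mul_measure_firstExceed_le (hanti : Antitone U)
    (hmeas : ∀ n, MeasurableSet (U n : Set X)) (hg : Measurable g) (N : ℕ) :
    a * μ (firstExceed μ U g a N) ≤ ∫⁻ z in firstExceed μ U g a N, g z ∂μ :=
  calc a * μ (firstExceed μ U g a N) = ∫⁻ _ in firstExceed μ U g a N, a ∂μ :=
        (setLIntegral_const _ _).symm
    _ ≤ ∫⁻ z in firstExceed μ U g a N, convAverage μ (U N) g z ∂μ :=
        setLIntegral_mono' (measurableSet_firstExceed hg N) fun _ hz => hz.1.le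
    _ ≤ _ := setLIntegral_convAverage_le (hmeas N) (measurableSet_firstExceed hg N)
        (fun z _ hv => sub_mem_firstExceed hanti hmeas hv z) hg

/-- Off the exceptional sets, the averages over `S` split into a part controlled by the level `a`
and the part that lives on the intermediate stopping levels. -/
theorem convAverage_le_add {D : ℝ≥0∞} (hD1 : 1 ≤ D) (hanti : Antitone U)
    (hmeas : ∀ n, MeasurableSet (U n : Set X)) (h0 : ∀ n, μ (U n : Set X) ≠ 0)
    (hD : ∀ n, μ (U n : Set X) ≤ D * μ (U (n + 1) : Set X))
    (hg : Measurable g) (hU0 : ∀ z, convAverage μ (U 0) g z ≤ a)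
    {q l j : ℕ} {v : X} {S : Set X} (hv : v ∈ U q) (hS : MeasurableSet S)
    (hSU : ∀ w ∈ S, ∀ u ∈ U (q + l + j), w + u ∈ S) (hSv : ∀ w ∈ S, w - v ∈ U (q + l))
    {z : X} (hz : ∀ N, z ∉ firstExceed μ U g a N)
    (hzv : ∀ i < l, z - v ∉ firstExceed μ U g a (q + i + 1)) :
    convAverage μ S g z ≤ D * a +
      convAverage μ S ((⋃ i : Fin j, firstExceed μ U g a (q + l + i)).indicator g) z := by
  set F := ⋃ i : Fin j, firstExceed μ U g a (q + l + i) with hF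
  -- The good points: no stopping before level q + l + j. The average at level q + l + j itself is
  -- then at most D * a, by comparison with the preceding level.
  set H : Set X := {y | ∀ i < q + l + j, convAverage μ (U i) g y ≤ a} with hH
  have hHm : MeasurableSet H := by
    have : H = ⋂ i ∈ Set.Iio (q + l + j), {z | convAverage μ (U i) g z ≤ a} := by
      ext z
      simp [hH]
    rw [this]
    exact MeasurableSet.biInter (Set.to_countable _) fun i _ =>
      measurableSet_le (measurable_convAverage _ hg) measurable_const
  have hHU : ∀ z, ∀ u ∈ U (q + l + j), z - u ∈ H ↔ z ∈ H := by
    intro z u hu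
    refine forall₂_congr fun i hi => ?_
    rw [convAverage_sub_of_mem (hmeas i) (hanti hi.le hu)]
  have hHle : ∀ y ∈ H, convAverage μ (U (q + l + j)) g y ≤ D * a := by
    intro y hy
    rcases Nat.eq_zero_or_pos (q + l + j) with h | h
    · rw [h]
      exact (hU0 y).trans (le_mul_of_one_le_left (zero_le) hD1)
    · obtain ⟨n, hn⟩ := Nat.exists_eq_succ_of_ne_zero h.ne'
      rw [hn]
      refine (convAverage_succ_le hanti h0 (fun n => measure_ne_top _ _) hD n y).trans ?_
      gcongr
      exact hy n (by omega)
  have hHavg : convAverage μ S (H.indicator g) z ≤ D * a := by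
    rw [← convAverage_convAverage (hmeas _) (h0 _) hS hSU (hg.indicator hHm)]
    refine convAverage_le_of_forall_le (fun y => ?_) z
    rw [convAverage_indicator (hmeas _) hHU]
    exact Set.indicator_apply_le' (fun hy => hHle y hy) fun _ => zero_le
  have hsplit : ∀ w ∈ S, g (z - w) ≤ H.indicator g (z - w) + F.indicator g (z - w) := by
    intro w hw
    by_cases hwH : z - w ∈ H
    · rw [Set.indicator_of_mem hwH]
      exact le_self_add
    suffices hwF : z - w ∈ F by
      rw [Set.indicator_of_mem hwF]
      exact le_add_self
    have hex : ∃ N, N < q + l + j ∧ a < convAverage μ (U N) g (z - w) := by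
      simpa [hH] using hwH
    classical
    let N := Nat.find hex
    have hN : N < q + l + j ∧ a < convAverage μ (U N) g (z - w) := Nat.find_spec hex
    have hNF : z - w ∈ firstExceed μ U g a N :=
      ⟨hN.2, fun i hi => not_lt.1 fun h => Nat.find_min hex hi ⟨hi.trans hN.1, h⟩⟩
    -- A stopping set of level N ≤ q + l is invariant under U (q + l), so it would contain z - v. If
    -- moreover N ≤ q, then v ∈ U N and it would contain z. Both are excluded by hypothesis.
    have hlt : q + l < N := by
      by_contra! hle
      have h1 : z - v ∈ firstExceed μ U g a N := by
        rw [← sub_mem_firstExceed hanti hmeas (hanti hle (hSv w hw)), sub_sub,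
          add_sub_cancel]
        exact hNF
      rcases le_or_gt N q with hq | hq
      · exact hz N ((sub_mem_firstExceed hanti hmeas (hanti hq hv) z).1 h1)
      · refine hzv (N - q - 1) (by omega) ?_
        rwa [show q + (N - q - 1) + 1 = N by omega]
    refine Set.mem_iUnion.2 ⟨⟨N - (q + l), by omega⟩, ?_⟩
    rwa [show q + l + (N - (q + l)) = N by omega]
  calc convAverage μ S g z
      ≤ convAverage μ S (fun y => H.indicator g y + F.indicator g y) z := by
        unfold convAverage
        exact mul_le_mul' le_rfl (setLIntegral_mono' hS hsplit)
    _ = convAverage μ S (H.indicator g) z + convAverage μ S (F.indicator g) z :=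
        convAverage_add (hg.indicator hHm) z
    _ ≤ _ := by gcongr

/-- The weak type (1,1) inequality for the maximal operator of the averages over sets `S q` that
are unions of cosets of `U (q + l + j)`, contained in one coset `v q + U (q + l)` with
`v q ∈ U q`. The constant is linear in `l` and `j`. -/
theorem mul_measure_iSup_convAverage_gt_le {D : ℝ≥0∞} (hD1 : 1 ≤ D) (hanti : Antitone U)
    (hmeas : ∀ n, MeasurableSet (U n : Set X)) (htop : U 0 = ⊤) (h0 : ∀ n, μ (U n : Set X) ≠ 0)
    (hD : ∀ n, μ (U n : Set X) ≤ D * μ (U (n + 1) : Set X))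
    (hg : Measurable g) {l j : ℕ} {v : ℕ → X} {S : ℕ → Set X} (hv : ∀ q, v q ∈ U q)
    (hS : ∀ q, MeasurableSet (S q))
    (hSU : ∀ q, ∀ w ∈ S q, ∀ u ∈ U (q + l + j), w + u ∈ S q)
    (hSv : ∀ q, ∀ w ∈ S q, w - v q ∈ U (q + l)) (a : ℝ≥0∞) :
    a * μ {z | (D + 1) * a < ⨆ q, convAverage μ (S q) g z} ≤ (1 + l + j) * ∫⁻ z, g z ∂μ := by
  -- For a at most the integral of g the claim is trivial, the total mass being 1. Otherwise the
  -- average over U 0, the whole group, stays below a, so that no point stops at level 0.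
  rcases lt_or_ge (∫⁻ z, g z ∂μ) a with hga | hga
  swap
  · calc a * μ {z | (D + 1) * a < ⨆ q, convAverage μ (S q) g z} ≤ a * 1 := by
          gcongr
          exact prob_le_one
      _ ≤ 1 * ∫⁻ z, g z ∂μ := by simpa using hga
      _ ≤ _ := by
          gcongr
          rw [add_assoc]
          exact le_self_add
  have hU0 : ∀ z, convAverage μ (U 0) g z ≤ a := by
    intro z
    have h1 : convAverage μ (U 0) g z = convAverage μ (U 0) g 0 := by
      have := convAverage_sub_of_mem (μ := μ) (g := g) (hmeas 0) (v := z) (by simp [htop]) z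
      rw [← this, sub_self]
    have h2 : ∫⁻ y, convAverage μ (U 0) g y ∂μ = convAverage μ (U 0) g z := by
      have h3 : ∀ y, convAverage μ (U 0) g y = convAverage μ (U 0) g z := by
        intro y
        have := convAverage_sub_of_mem (μ := μ) (g := g) (hmeas 0) (v := y - z)
          (by simp [htop]) y
        rw [← this, sub_sub_cancel]
      simp_rw [h3]
      simp
    rw [← h2]
    exact (lintegral_convAverage_le _ hg).trans hga.le
  set Ω : ℕ → Set X := firstExceed μ U g a with hΩ
  set F : ℕ → Set X := fun q => ⋃ i : Fin j, Ω (q + l + i) with hF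
  have hFm : ∀ q, MeasurableSet (F q) := fun q =>
    MeasurableSet.iUnion fun i => measurableSet_firstExceed hg _
  have hsub : {z | (D + 1) * a < ⨆ q, convAverage μ (S q) g z} ⊆
      (⋃ N, Ω N) ∪ (⋃ i : Fin l, ⋃ q, {z | z - v q ∈ Ω (q + i + 1)}) ∪
        ⋃ q, {z | a < convAverage μ (S q) ((F q).indicator g) z} := by
    intro z hz
    by_contra hcon
    simp only [Set.mem_union, Set.mem_iUnion, Set.mem_ofPred_eq, not_or, not_exists] at hcon
    obtain ⟨⟨h1, h2⟩, h3⟩ := hcon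
    refine (Set.mem_ofPred_eq ▸ hz : _ < _).not_ge (iSup_le fun q => ?_)
    calc convAverage μ (S q) g z ≤ D * a + convAverage μ (S q) ((F q).indicator g) z :=
          convAverage_le_add hD1 hanti hmeas h0 hD hg hU0 (hv q) (hS q) (hSU q) (hSv q) h1
            fun i hi => h2 ⟨i, hi⟩ q
      _ ≤ D * a + a := by gcongr; exact not_lt.1 (h3 q)
      _ = (D + 1) * a := by ring
  have hA : a * μ (⋃ N, Ω N) ≤ ∫⁻ z, g z ∂μ :=
    calc a * μ (⋃ N, Ω N) ≤ a * ∑' N, μ (Ω N) := by gcongr; exact measure_iUnion_le _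
      _ = ∑' N, a * μ (Ω N) := ENNReal.tsum_mul_left.symm
      _ ≤ ∑' N, ∫⁻ z in Ω N, g z ∂μ :=
          ENNReal.tsum_le_tsum fun N => mul_measure_firstExceed_le hanti hmeas hg N
      _ ≤ _ := tsum_setLIntegral_firstExceed_le hg Function.injective_id
  -- Translation by v q preserves measure, and for each fixed i the levels q + i + 1 are distinct:
  -- each of the l values of i costs one integral of g.
  have hB : a * μ (⋃ i : Fin l, ⋃ q, {z | z - v q ∈ Ω (q + i + 1)}) ≤ l * ∫⁻ z, g z ∂μ :=
    calc a * μ (⋃ i : Fin l, ⋃ q, {z | z - v q ∈ Ω (q + i + 1)})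
        ≤ a * ∑ i : Fin l, ∑' q, μ {z | z - v q ∈ Ω (q + i + 1)} := by
          gcongr
          refine (measure_iUnion_fintype_le _ _).trans ?_
          gcongr
          exact measure_iUnion_le _
      _ = ∑ i : Fin l, ∑' q, a * μ (Ω (q + i + 1)) := by
          rw [Finset.mul_sum]
          refine Finset.sum_congr rfl fun i _ => ?_
          rw [← ENNReal.tsum_mul_left]
          refine tsum_congr fun q => ?_
          congr 1
          have := measure_preimage_add_right μ (-v q) (Ω (q + i + 1))
          simpa [sub_eq_add_neg, Set.preimage] using this
      _ ≤ ∑ i : Fin l, ∑' q, ∫⁻ z in Ω (q + i + 1), g z ∂μ := by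
          gcongr
          exact mul_measure_firstExceed_le hanti hmeas hg _
      _ ≤ ∑ i : Fin l, ∫⁻ z, g z ∂μ := by
          gcongr with i
          exact tsum_setLIntegral_firstExceed_le hg (φ := fun q => q + i + 1)
            fun x y h => by simpa using h
      _ = _ := by simp
  -- Chebyshev for each q. A given stopping level occurs in F q for at most j values of q.
  have hC : a * μ (⋃ q, {z | a < convAverage μ (S q) ((F q).indicator g) z}) ≤
      j * ∫⁻ z, g z ∂μ :=
    calc a * μ (⋃ q, {z | a < convAverage μ (S q) ((F q).indicator g) z})
        ≤ a * ∑' q, μ {z | a < convAverage μ (S q) ((F q).indicator g) z} := by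
          gcongr
          exact measure_iUnion_le _
      _ = ∑' q, a * μ {z | a < convAverage μ (S q) ((F q).indicator g) z} :=
          ENNReal.tsum_mul_left.symm
      _ ≤ ∑' q, ∫⁻ z, (F q).indicator g z ∂μ :=
          ENNReal.tsum_le_tsum fun q =>
            mul_measure_convAverage_gt_le _ (hg.indicator (hFm q)) a
      _ ≤ ∑' q, ∑ i : Fin j, ∫⁻ z in Ω (q + l + i), g z ∂μ := by
          refine ENNReal.tsum_le_tsum fun q => ?_
          rw [lintegral_indicator (hFm q), ← tsum_fintype (L := .unconditional _)]
          exact lintegral_iUnion_le _ _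
      _ = ∑ i : Fin j, ∑' q, ∫⁻ z in Ω (q + l + i), g z ∂μ :=
          Summable.tsum_finsetSum fun _ _ => ENNReal.summable
      _ ≤ ∑ i : Fin j, ∫⁻ z, g z ∂μ := by
          gcongr with i
          exact tsum_setLIntegral_firstExceed_le hg (φ := fun q => q + l + i)
            fun x y h => by simpa using h
      _ = _ := by simp
  calc a * μ {z | (D + 1) * a < ⨆ q, convAverage μ (S q) g z}
      ≤ a * (μ (⋃ N, Ω N) + μ (⋃ i : Fin l, ⋃ q, {z | z - v q ∈ Ω (q + i + 1)}) +
          μ (⋃ q, {z | a < convAverage μ (S q) ((F q).indicator g) z})) := by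
        gcongr
        exact (measure_mono hsub).trans ((measure_union_le _ _).trans
          (add_le_add_left (measure_union_le _ _) _))
    _ = a * μ (⋃ N, Ω N) + a * μ (⋃ i : Fin l, ⋃ q, {z | z - v q ∈ Ω (q + i + 1)}) +
          a * μ (⋃ q, {z | a < convAverage μ (S q) ((F q).indicator g) z}) := by ring
    _ ≤ ∫⁻ z, g z ∂μ + l * ∫⁻ z, g z ∂μ + j * ∫⁻ z, g z ∂μ := by gcongr
    _ = _ := by ring

end WeakType

/-! ### Layer cake formula, Marcinkiewicz interpolation, and summation in weak L^1. -/

section Interpolation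

/-- The layer cake formula at a single point, including x = ∞. Finite values come from the
real-valued formula for a Dirac measure, and ∞ by monotonicity from finite ones. -/
theorem rpow_eq_lintegral_Ioi {s : ℝ} (hs : 0 < s) (x : ℝ≥0∞) :
    x ^ s = ENNReal.ofReal s *
      ∫⁻ t in Set.Ioi (0 : ℝ), {t | ENNReal.ofReal t < x}.indicator 1 t *
        ENNReal.ofReal (t ^ (s - 1)) := by
  have key : ∀ y : ℝ≥0, (y : ℝ≥0∞) ^ s = ENNReal.ofReal s *
      ∫⁻ t in Set.Ioi (0 : ℝ), {t | ENNReal.ofReal t < y}.indicator 1 t *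
        ENNReal.ofReal (t ^ (s - 1)) := by
    intro y
    have h := lintegral_rpow_eq_lintegral_meas_lt_mul (Measure.dirac ())
      (f := fun _ => (y : ℝ)) (Filter.Eventually.of_forall fun _ => y.coe_nonneg)
      measurable_const.aemeasurable hs
    rw [lintegral_dirac, ← ENNReal.ofReal_rpow_of_nonneg y.coe_nonneg hs.le,
      ENNReal.ofReal_coe_nnreal] at h
    rw [h]
    congr 1
    refine setLIntegral_congr_fun measurableSet_Ioi fun t ht => ?_
    have ht0 : (0 : ℝ) < t := ht
    by_cases hty : t < y
    · have h1 : ENNReal.ofReal t < y := by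
        rwa [← ENNReal.ofReal_coe_nnreal, ENNReal.ofReal_lt_ofReal_iff_of_nonneg ht0.le]
      simp [hty, Set.indicator, h1]
    · have h1 : ¬ ENNReal.ofReal t < y := by
        rwa [← ENNReal.ofReal_coe_nnreal, ENNReal.ofReal_lt_ofReal_iff_of_nonneg ht0.le]
      simp only [hty, Set.indicator, Set.mem_ofPred_eq, h1]
      simp
  induction x with
  | coe y => exact key y
  | top =>
    rw [ENNReal.top_rpow_of_pos hs]
    refine (ENNReal.eq_top_of_forall_nnreal_le fun y => ?_).symm
    have h1 : (y : ℝ≥0∞) = ((y ^ (1 / s) : ℝ≥0) : ℝ≥0∞) ^ s := by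
      rw [← ENNReal.coe_rpow_of_nonneg _ hs.le, ← NNReal.rpow_mul, one_div_mul_cancel hs.ne',
        NNReal.rpow_one]
    rw [h1, key]
    refine mul_le_mul' le_rfl (lintegral_mono fun t => mul_le_mul' ?_ le_rfl)
    exact Set.indicator_le_indicator_of_subset (fun t _ => ENNReal.ofReal_lt_top)
      (fun _ => zero_le) t

variable {X : Type*} [MeasurableSpace X] {μ : Measure X}

theorem lintegral_rpow_eq_lintegral_measure_gt [SFinite μ] {s : ℝ} (hs : 0 < s) {h : X → ℝ≥0∞}
    (hh : Measurable h) :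
    ∫⁻ z, h z ^ s ∂μ = ENNReal.ofReal s *
      ∫⁻ t in Set.Ioi (0 : ℝ), μ {z | ENNReal.ofReal t < h z} * ENNReal.ofReal (t ^ (s - 1)) := by
  have hm : MeasurableSet {p : X × ℝ | ENNReal.ofReal p.2 < h p.1} :=
    measurableSet_lt (ENNReal.measurable_ofReal.comp measurable_snd) (hh.comp measurable_fst)
  have hm2 : Measurable (Function.uncurry fun (z : X) (t : ℝ) =>
      {t | ENNReal.ofReal t < h z}.indicator (1 : ℝ → ℝ≥0∞) t * ENNReal.ofReal (t ^ (s - 1))) := by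
    refine Measurable.mul (f := fun p : X × ℝ => _) ?_
      (ENNReal.measurable_ofReal.comp (measurable_snd.pow_const _))
    exact (measurable_one.indicator hm : Measurable
      ({p : X × ℝ | ENNReal.ofReal p.2 < h p.1}.indicator (1 : X × ℝ → ℝ≥0∞)))
  simp_rw [fun z => rpow_eq_lintegral_Ioi hs (h z)]
  rw [lintegral_const_mul (f := fun z => ∫⁻ t in Set.Ioi (0 : ℝ),
    {t | ENNReal.ofReal t < h z}.indicator 1 t * ENNReal.ofReal (t ^ (s - 1))) _
    hm2.lintegral_prod_right', lintegral_lintegral_swap hm2.aemeasurable]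
  congr 1
  refine lintegral_congr fun t => ?_
  have hmt : MeasurableSet {z | ENNReal.ofReal t < h z} := measurableSet_lt measurable_const hh
  rw [lintegral_mul_const (f := fun z => {t | ENNReal.ofReal t < h z}.indicator 1 t) _
    (measurable_one.indicator hmt :
      Measurable ({z | ENNReal.ofReal t < h z}.indicator (1 : X → ℝ≥0∞)))]
  congr 1
  exact lintegral_indicator_one hmt

/-- The Marcinkiewicz interpolation theorem between the weak type (1,1) and the `L^∞` bound, for a
sublinear operator on nonnegative functions. -/
theorem lintegral_rpow_le_of_weakType [SFinite μ] {T : (X → ℝ≥0∞) → X → ℝ≥0∞}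
    (hTm : ∀ g, Measurable g → Measurable (T g))
    (hadd : ∀ g h, Measurable g → Measurable h → ∀ z, T (fun z => g z + h z) z ≤ T g z + T h z)
    {K C : ℝ≥0∞} (hK0 : K ≠ 0) (hK : K ≠ ∞)
    (hTtop : ∀ g a, (∀ z, g z ≤ a) → ∀ z, T g z ≤ K * a)
    (hweak : ∀ g, Measurable g → ∀ a, a * μ {z | a < T g z} ≤ C * ∫⁻ z, g z ∂μ)
    {s : ℝ} (hs : 1 < s) {g : X → ℝ≥0∞} (hg : Measurable g) :
    ∫⁻ z, T g z ^ s ∂μ ≤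
      (2 * K) ^ s * (ENNReal.ofReal s * (C / K) * (ENNReal.ofReal (s - 1))⁻¹) *
        ∫⁻ z, g z ^ s ∂μ := by
  have hs0 : 0 < s := one_pos.trans hs
  have hs1 : 0 < s - 1 := sub_pos.2 hs
  -- Cut g at height t. The part below contributes at most K * t to T g, so where T g > 2 * K * t
  -- the part above contributes more than K * t, and the weak type bound applies to it.
  have hlevel : ∀ t ∈ Set.Ioi (0 : ℝ), μ {z | ENNReal.ofReal t < (2 * K)⁻¹ * T g z} ≤
      C / K * ((ENNReal.ofReal t)⁻¹ * ∫⁻ z in {z | ENNReal.ofReal t < g z}, g z ∂μ) := by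
    intro t ht
    have ht0 : ENNReal.ofReal t ≠ 0 := (ENNReal.ofReal_pos.2 ht).ne'
    set b := ENNReal.ofReal t with hb
    have hbt : b ≠ ∞ := ENNReal.ofReal_ne_top
    have hm : MeasurableSet {z | b < g z} := measurableSet_lt measurable_const hg
    have hsub : {z | b < (2 * K)⁻¹ * T g z} ⊆ {z | K * b < T ({z | b < g z}.indicator g) z} := by
      intro z hz
      by_contra hcon
      have hcon' : T ({z | b < g z}.indicator g) z ≤ K * b := not_lt.1 hcon
      have h1 : T g z ≤ 2 * K * b := by
        have hdec : g = fun z => {z | b < g z}.indicator g z + {z | b < g z}ᶜ.indicator g z := by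
          funext z
          exact (congrFun (Set.indicator_self_add_compl _ g) z).symm
        have hsmall : T ({z | b < g z}ᶜ.indicator g) z ≤ K * b :=
          hTtop _ _ (fun y => Set.indicator_apply_le' (fun hy => not_lt.1 hy) fun _ => zero_le) z
        calc T g z = T (fun z => {z | b < g z}.indicator g z + {z | b < g z}ᶜ.indicator g z) z := by
              rw [← hdec]
          _ ≤ _ := hadd _ _ (hg.indicator hm) (hg.indicator hm.compl) z
          _ ≤ K * b + K * b := by gcongr
          _ = 2 * K * b := by ring
      refine (Set.mem_ofPred_eq ▸ hz : _ < _).not_ge ?_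
      calc (2 * K)⁻¹ * T g z ≤ (2 * K)⁻¹ * (2 * K * b) := by gcongr
        _ = ((2 * K)⁻¹ * (2 * K)) * b := by ring
        _ ≤ 1 * b := by gcongr; exact ENNReal.inv_mul_le_one _
        _ = b := one_mul b
    have hKb0 : K * b ≠ 0 := mul_ne_zero hK0 ht0
    have hKbt : K * b ≠ ∞ := ENNReal.mul_ne_top hK hbt
    have h2 := hweak _ (hg.indicator hm) (K * b)
    rw [lintegral_indicator hm] at h2
    calc μ {z | b < (2 * K)⁻¹ * T g z}
        ≤ μ {z | K * b < T ({z | b < g z}.indicator g) z} := measure_mono hsub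
      _ ≤ (C * ∫⁻ z in {z | b < g z}, g z ∂μ) / (K * b) := by
          rw [ENNReal.le_div_iff_mul_le (Or.inl hKb0) (Or.inl hKbt), mul_comm]
          exact h2
      _ = _ := by
          rw [div_eq_mul_inv, div_eq_mul_inv, ENNReal.mul_inv (Or.inl hK0) (Or.inl hK)]
          ring
  have hscaled : ∫⁻ z, ((2 * K)⁻¹ * T g z) ^ s ∂μ ≤
      ENNReal.ofReal s * (C / K) * (ENNReal.ofReal (s - 1))⁻¹ * ∫⁻ z, g z ^ s ∂μ := by
    have hm : MeasurableSet {p : ℝ × X | ENNReal.ofReal p.1 < g p.2} :=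
      measurableSet_lt (ENNReal.measurable_ofReal.comp measurable_fst) (hg.comp measurable_snd)
    have hm3 : Measurable (Function.uncurry fun (t : ℝ) (z : X) =>
        ({t | ENNReal.ofReal t < g z}.indicator (1 : ℝ → ℝ≥0∞) t *
          ENNReal.ofReal (t ^ (s - 1 - 1))) * g z) := by
      refine Measurable.mul (f := fun p : ℝ × X => _) (Measurable.mul (f := fun p : ℝ × X => _) ?_
        (ENNReal.measurable_ofReal.comp (measurable_fst.pow_const _))) (hg.comp measurable_snd)
      exact (measurable_one.indicator hm : Measurable
        ({p : ℝ × X | ENNReal.ofReal p.1 < g p.2}.indicator (1 : ℝ × X → ℝ≥0∞)))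
    have hpoint : ∀ z, ∫⁻ t in Set.Ioi (0 : ℝ), ({t | ENNReal.ofReal t < g z}.indicator 1 t *
          ENNReal.ofReal (t ^ (s - 1 - 1))) * g z =
        (ENNReal.ofReal (s - 1))⁻¹ * g z ^ s := by
      intro z
      have hmz : MeasurableSet {t : ℝ | ENNReal.ofReal t < g z} :=
        measurableSet_lt ENNReal.measurable_ofReal measurable_const
      have hmf : Measurable fun t : ℝ => {t | ENNReal.ofReal t < g z}.indicator (1 : ℝ → ℝ≥0∞) t *
          ENNReal.ofReal (t ^ (s - 1 - 1)) :=
        (measurable_one.indicator hmz : Measurable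
          ({t | ENNReal.ofReal t < g z}.indicator (1 : ℝ → ℝ≥0∞))).mul
          (ENNReal.measurable_ofReal.comp (measurable_id.pow_const _))
      have h0 : ENNReal.ofReal (s - 1) ≠ 0 := (ENNReal.ofReal_pos.2 hs1).ne'
      rw [lintegral_mul_const _ hmf]
      have h := rpow_eq_lintegral_Ioi hs1 (g z)
      have h4 : ∫⁻ t in Set.Ioi (0 : ℝ), {t | ENNReal.ofReal t < g z}.indicator 1 t *
          ENNReal.ofReal (t ^ (s - 1 - 1)) = (ENNReal.ofReal (s - 1))⁻¹ * g z ^ (s - 1) := by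
        rw [h, ← mul_assoc, ENNReal.inv_mul_cancel h0 ENNReal.ofReal_ne_top, one_mul]
      rw [h4, mul_assoc]
      congr 1
      nth_rw 2 [← ENNReal.rpow_one (g z)]
      rw [← ENNReal.rpow_add_of_nonneg _ _ hs1.le zero_le_one]
      congr 1
      ring
    rw [lintegral_rpow_eq_lintegral_measure_gt hs0 ((hTm g hg).const_mul _)]
    calc ENNReal.ofReal s * ∫⁻ t in Set.Ioi (0 : ℝ),
          μ {z | ENNReal.ofReal t < (2 * K)⁻¹ * T g z} * ENNReal.ofReal (t ^ (s - 1))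
        ≤ ENNReal.ofReal s * ∫⁻ t in Set.Ioi (0 : ℝ), C / K *
            ∫⁻ z, ({t | ENNReal.ofReal t < g z}.indicator 1 t *
              ENNReal.ofReal (t ^ (s - 1 - 1))) * g z ∂μ := by
          refine mul_le_mul' le_rfl (setLIntegral_mono' measurableSet_Ioi fun t ht => ?_)
          have ht0 : (0 : ℝ) < t := ht
          have hmt : MeasurableSet {z | ENNReal.ofReal t < g z} :=
            measurableSet_lt measurable_const hg
          calc μ {z | ENNReal.ofReal t < (2 * K)⁻¹ * T g z} * ENNReal.ofReal (t ^ (s - 1))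
              ≤ C / K * ((ENNReal.ofReal t)⁻¹ *
                ∫⁻ z in {z | ENNReal.ofReal t < g z}, g z ∂μ) * ENNReal.ofReal (t ^ (s - 1)) := by
                gcongr
                exact hlevel t ht
            _ = C / K * (ENNReal.ofReal (t ^ (s - 1 - 1)) *
                ∫⁻ z in {z | ENNReal.ofReal t < g z}, g z ∂μ) := by
                have h5 : t ^ (s - 1 - 1) = t⁻¹ * t ^ (s - 1) := by
                  rw [Real.rpow_sub_one ht0.ne']
                  field_simp
                rw [h5, ENNReal.ofReal_mul (inv_nonneg.2 ht0.le), ENNReal.ofReal_inv_of_pos ht0]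
                ring
            _ = _ := by
                rw [← lintegral_indicator hmt, ← lintegral_const_mul _ (hg.indicator hmt)]
                congr 1
                refine lintegral_congr fun z => ?_
                by_cases hz : ENNReal.ofReal t < g z
                · simp [Set.indicator, hz]
                · simp only [Set.indicator, Set.mem_ofPred_eq, hz]
                  simp
      _ = ENNReal.ofReal s * (C / K * ∫⁻ z, (ENNReal.ofReal (s - 1))⁻¹ * g z ^ s ∂μ) := by
          rw [lintegral_const_mul (f := fun t => ∫⁻ z, ({t | ENNReal.ofReal t < g z}.indicator 1 t *
              ENNReal.ofReal (t ^ (s - 1 - 1))) * g z ∂μ) _ hm3.lintegral_prod_right',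
            lintegral_lintegral_swap hm3.aemeasurable]
          simp_rw [hpoint]
      _ = _ := by
          rw [lintegral_const_mul _ (hg.pow_const s)]
          ring
  have h2K0 : 2 * K ≠ 0 := mul_ne_zero two_ne_zero hK0
  have h2Kt : 2 * K ≠ ∞ := ENNReal.mul_ne_top ENNReal.ofNat_ne_top hK
  calc ∫⁻ z, T g z ^ s ∂μ = ∫⁻ z, (2 * K) ^ s * ((2 * K)⁻¹ * T g z) ^ s ∂μ := by
        refine lintegral_congr fun z => ?_
        rw [← ENNReal.mul_rpow_of_nonneg _ _ hs0.le, ← mul_assoc,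
          ENNReal.mul_inv_cancel h2K0 h2Kt, one_mul]
    _ = (2 * K) ^ s * ∫⁻ z, ((2 * K)⁻¹ * T g z) ^ s ∂μ :=
        lintegral_const_mul _ (((hTm g hg).const_mul _).pow_const s)
    _ ≤ _ := by
        rw [mul_assoc]
        gcongr

/-- A weighted sum of functions in weak `L^1`. -/
theorem mul_measure_tsum_gt_le {ι : Type*} [Countable ι] {h : ι → X → ℝ≥0∞} {c w K : ι → ℝ≥0∞}
    {D J : ℝ≥0∞} (hD0 : D ≠ 0) (hDt : D ≠ ∞) (hc0 : ∀ i, c i ≠ 0) (hct : ∀ i, c i ≠ ∞)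
    (hw0 : ∀ i, w i ≠ 0) (hw : ∑' i, w i ≤ 1)
    (hweak : ∀ i a, a * μ {z | D * a < h i z} ≤ K i * J) (a : ℝ≥0∞) :
    a * μ {z | a < ∑' i, c i * h i z} ≤ (∑' i, c i * D / w i * K i) * J := by
  have hwt : ∀ i, w i ≠ ∞ := fun i =>
    ((ENNReal.le_tsum i).trans hw).trans_lt ENNReal.one_lt_top |>.ne
  -- The height a is distributed among the terms in proportion to w: if every c i * h i z is at most
  -- w i * a, the sum is at most a.
  have hsub : {z | a < ∑' i, c i * h i z} ⊆ ⋃ i, {z | D * (w i * a / (c i * D)) < h i z} := by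
    intro z hz
    by_contra hcon
    simp only [Set.mem_iUnion, Set.mem_ofPred_eq, not_exists, not_lt] at hcon
    refine (Set.mem_ofPred_eq ▸ hz : _ < _).not_ge ?_
    calc ∑' i, c i * h i z ≤ ∑' i, w i * a := by
          refine ENNReal.tsum_le_tsum fun i => ?_
          calc c i * h i z ≤ c i * (D * (w i * a / (c i * D))) := by gcongr; exact hcon i
            _ = (c i * D) * (w i * a / (c i * D)) := by ring
            _ ≤ w i * a := ENNReal.mul_div_le
      _ = (∑' i, w i) * a := ENNReal.tsum_mul_right
      _ ≤ 1 * a := by gcongr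
      _ = a := one_mul a
  calc a * μ {z | a < ∑' i, c i * h i z}
      ≤ a * ∑' i, μ {z | D * (w i * a / (c i * D)) < h i z} := by
        gcongr
        exact (measure_mono hsub).trans (measure_iUnion_le _)
    _ = ∑' i, a * μ {z | D * (w i * a / (c i * D)) < h i z} := ENNReal.tsum_mul_left.symm
    _ ≤ ∑' i, c i * D / w i * K i * J := by
        refine ENNReal.tsum_le_tsum fun i => ?_
        have hcD0 : c i * D ≠ 0 := mul_ne_zero (hc0 i) hD0
        have hcDt : c i * D ≠ ∞ := ENNReal.mul_ne_top (hct i) hDt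
        have h1 : a = c i * D / w i * (w i * a / (c i * D)) := by
          rw [div_eq_mul_inv, div_eq_mul_inv]
          calc a = (c i * D * (c i * D)⁻¹) * ((w i)⁻¹ * w i) * a := by
                rw [ENNReal.mul_inv_cancel hcD0 hcDt, ENNReal.inv_mul_cancel (hw0 i) (hwt i)]
                simp
            _ = _ := by ring
        calc a * μ {z | D * (w i * a / (c i * D)) < h i z}
            = c i * D / w i *
              ((w i * a / (c i * D)) * μ {z | D * (w i * a / (c i * D)) < h i z}) := by
              rw [← mul_assoc, ← h1]
          _ ≤ c i * D / w i * (K i * J) := by exact mul_le_mul' le_rfl (hweak i _)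
          _ = _ := by ring
    _ = _ := ENNReal.tsum_mul_right

end Interpolation

/-! ### Haar measure and the cube subgroups of the Vilenkin group. -/

section Group

variable {m : ℕ → ℕ}

instance isProbabilityMeasure_uniformOn_zmod (n : ℕ) [NeZero n] :
    IsProbabilityMeasure (ProbabilityTheory.uniformOn (Set.univ : Set (ZMod n))) :=
  ProbabilityTheory.isProbabilityMeasure_uniformOn Set.finite_univ Set.univ_nonempty

theorem uniformOn_zmod_singleton (n : ℕ) [NeZero n] (c : ZMod n) :
    ProbabilityTheory.uniformOn (Set.univ : Set (ZMod n)) {c} = (n : ℝ≥0∞)⁻¹ := by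
  rw [ProbabilityTheory.uniformOn_univ, Measure.count_singleton, ZMod.card, one_div]

theorem map_const_add_uniformOn_zmod (n : ℕ) [NeZero n] (c : ZMod n) :
    (ProbabilityTheory.uniformOn (Set.univ : Set (ZMod n))).map (fun x => c + x) =
      ProbabilityTheory.uniformOn (Set.univ : Set (ZMod n)) := by
  refine Measure.ext_of_singleton fun a => ?_
  rw [Measure.map_apply (measurable_of_countable _) (measurableSet_singleton a),
    uniformOn_zmod_singleton]
  have h : (fun x => c + x) ⁻¹' {a} = {a - c} := by
    ext x
    simp only [Set.mem_preimage, Set.mem_singleton_iff]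
    rw [eq_sub_iff_add_eq, add_comm]
  rw [h, uniformOn_zmod_singleton]

/-- The subgroup `I_n × I_n` of `G_m × G_m`. -/
def cubeSubgroup (m : ℕ → ℕ) (n : ℕ) : AddSubgroup (G m × G m) where
  carrier := I n 0 ×ˢ I n 0
  zero_mem' := ⟨mem_I_self n 0, mem_I_self n 0⟩
  add_mem' {a b} ha hb := ⟨fun j hj => by simp [ha.1 j hj, hb.1 j hj],
    fun j hj => by simp [ha.2 j hj, hb.2 j hj]⟩
  neg_mem' {a} ha := ⟨fun j hj => by simp [ha.1 j hj], fun j hj => by simp [ha.2 j hj]⟩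

theorem antitone_cubeSubgroup : Antitone (cubeSubgroup m) := fun _ _ hab _ hx =>
  ⟨fun j hj => hx.1 j (hj.trans_le hab), fun j hj => hx.2 j (hj.trans_le hab)⟩

theorem measurableSet_cubeSubgroup (n : ℕ) :
    MeasurableSet (cubeSubgroup m n : Set (G m × G m)) :=
  (measurableSet_I n 0).prod (measurableSet_I n 0)

theorem cubeSubgroup_zero : cubeSubgroup m 0 = ⊤ :=
  (AddSubgroup.eq_top_iff' _).2 fun _ => ⟨fun j hj => absurd hj j.not_lt_zero,
    fun j hj => absurd hj j.not_lt_zero⟩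

variable [∀ k, NeZero (m k)]

instance measurableAdd₂_G : MeasurableAdd₂ (G m) := by
  refine ⟨measurable_pi_lambda _ fun k => ?_⟩
  have h : Measurable fun p : ZMod (m k) × ZMod (m k) => p.1 + p.2 := measurable_of_countable _
  exact h.comp (g := fun p : ZMod (m k) × ZMod (m k) => p.1 + p.2)
    (f := fun c : G m × G m => (c.1 k, c.2 k))
    (((measurable_pi_apply k).comp measurable_fst).prodMk
      ((measurable_pi_apply k).comp measurable_snd))

instance measurableNeg_G : MeasurableNeg (G m) :=
  ⟨measurable_pi_lambda _ fun k => show Measurable fun c : G m => -c k from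
    (measurable_of_countable fun p : ZMod (m k) => -p).comp (measurable_pi_apply k)⟩

instance isProbabilityMeasure_haar : IsProbabilityMeasure (haar m) :=
  inferInstanceAs (IsProbabilityMeasure (Measure.infinitePi _))

instance isProbabilityMeasure_haar₂ : IsProbabilityMeasure (haar₂ m) :=
  inferInstanceAs (IsProbabilityMeasure ((haar m).prod (haar m)))

instance isAddLeftInvariant_haar : (haar m).IsAddLeftInvariant := by
  refine ⟨fun g => ?_⟩
  have h := Measure.infinitePi_map_pi
    (fun k => ProbabilityTheory.uniformOn (Set.univ : Set (ZMod (m k))))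
    (f := fun k x => g k + x) fun k => measurable_of_countable _
  simp_rw [map_const_add_uniformOn_zmod] at h
  exact h

instance isAddLeftInvariant_haar₂ : (haar₂ m).IsAddLeftInvariant :=
  Measure.prod.instIsAddLeftInvariant (μ := haar m) (ν := haar m)

theorem haar_cylinder (s : Finset ℕ) (c : G m) :
    haar m {y | ∀ k ∈ s, y k = c k} = ∏ k ∈ s, ((m k : ℕ) : ℝ≥0∞)⁻¹ := by
  have h : {y : G m | ∀ k ∈ s, y k = c k} = (s : Set ℕ).pi fun k => {c k} := by
    ext y
    simp [Set.mem_pi]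
  rw [h]
  refine (Measure.infinitePi_pi _ fun k _ => measurableSet_singleton _).trans ?_
  exact Finset.prod_congr rfl fun k _ => uniformOn_zmod_singleton _ _

theorem M_pos (m : ℕ → ℕ) [∀ k, NeZero (m k)] (n : ℕ) : 0 < M m n :=
  Finset.prod_pos fun _ _ => Nat.pos_of_neZero _

theorem prod_inv_eq (s : Finset ℕ) :
    ∏ k ∈ s, ((m k : ℕ) : ℝ≥0∞)⁻¹ = ENNReal.ofReal (∏ k ∈ s, (m k : ℝ))⁻¹ := by
  rw [← Finset.prod_inv_distrib, ENNReal.ofReal_prod_of_nonneg fun k _ => by positivity]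
  refine Finset.prod_congr rfl fun k _ => ?_
  rw [ENNReal.ofReal_inv_of_pos (by exact_mod_cast Nat.pos_of_neZero (m k)),
    ENNReal.ofReal_natCast]

theorem haar_I (n : ℕ) (x : G m) : haar m (I n x) = ENNReal.ofReal (M m n : ℝ)⁻¹ := by
  have h : I n x = {y : G m | ∀ k ∈ Finset.range n, y k = x k} := by
    ext y
    simp [I]
  rw [h, haar_cylinder, prod_inv_eq]
  simp [M]

theorem measurableSet_antiDiag (a b : ℕ) : MeasurableSet (antiDiag m a b) := by
  have h : antiDiag m a b = ⋂ r ∈ Set.Ico a b, (fun z : G m × G m => z.1 r + z.2 r) ⁻¹' {0} := by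
    ext z
    simp [antiDiag]
  rw [h]
  refine MeasurableSet.biInter (Set.to_countable _) fun r _ => ?_
  refine measurableSet_preimage ?_ (measurableSet_singleton 0)
  exact (measurable_pi_apply r).comp (measurable_fst.add measurable_snd)

/-- Fix t. Then u is prescribed in every coordinate below n except the k-th: it is 0 before k and -t
after k. Each fibre thus has measure at most m_k / M_n, and t ranges over a set of measure 1 / M_k.
-/
theorem haar₂_prod_inter_antiDiag_le {k n : ℕ} (hkn : k < n) (x : G m) :
    haar₂ m ((I k x ×ˢ I k 0) ∩ antiDiag m (k + 1) n) ≤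
      ENNReal.ofReal ((m k : ℝ) / (M m k * M m n)) := by
  have hmeas : MeasurableSet ((I k x ×ˢ I k 0) ∩ antiDiag m (k + 1) n) :=
    ((measurableSet_I k x).prod (measurableSet_I k 0)).inter (measurableSet_antiDiag _ _)
  unfold haar₂
  rw [Measure.prod_apply hmeas]
  have hmk : (0 : ℝ) < m k := by exact_mod_cast Nat.pos_of_neZero (m k)
  have hprod : (∏ r ∈ (Finset.range n).erase k, (m r : ℝ))⁻¹ = m k / M m n := by
    have h := Finset.mul_prod_erase (Finset.range n) (fun r => (m r : ℝ)) (Finset.mem_range.2 hkn)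
    have hM : (M m n : ℝ) = ∏ r ∈ Finset.range n, (m r : ℝ) := by simp [M]
    rw [hM, ← h, div_mul_cancel_left₀ hmk.ne']
  have hfib : ∀ t, haar m (Prod.mk t ⁻¹' ((I k x ×ˢ I k 0) ∩ antiDiag m (k + 1) n)) ≤
      (I k x).indicator (fun _ => ENNReal.ofReal (m k / M m n)) t := by
    intro t
    by_cases ht : t ∈ I k x
    · rw [Set.indicator_of_mem ht, ← hprod, ← prod_inv_eq,
        ← haar_cylinder _ fun r => if r < k then 0 else -t r]
      refine measure_mono fun u hu r hr => ?_
      obtain ⟨⟨_, hu1⟩, hu2⟩ := hu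
      have hr' := Finset.mem_erase.1 hr
      have hrn := Finset.mem_range.1 hr'.2
      by_cases hrk : r < k
      · simpa [hrk] using hu1 r hrk
      · have := hu2 r (by omega) hrn
        simpa [hrk] using eq_neg_of_add_eq_zero_right this
    · rw [Set.indicator_of_notMem ht, nonpos_iff_eq_zero]
      convert measure_empty (μ := haar m)
      ext u
      simp [ht]
  refine (lintegral_mono hfib).trans ?_
  rw [lintegral_indicator (measurableSet_I k x), setLIntegral_const, haar_I,
    ← ENNReal.ofReal_mul (by positivity)]
  refine ENNReal.ofReal_le_ofReal (le_of_eq ?_)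
  have h1 : (0 : ℝ) < M m k := by exact_mod_cast M_pos m k
  have h2 : (0 : ℝ) < M m n := by exact_mod_cast M_pos m n
  field_simp

theorem haar₂_cubeSubgroup (n : ℕ) :
    haar₂ m (cubeSubgroup m n : Set (G m × G m)) =
      ENNReal.ofReal ((M m n : ℝ)⁻¹ * (M m n : ℝ)⁻¹) := by
  change (haar m).prod (haar m) (I n 0 ×ˢ I n 0) = _
  rw [Measure.prod_prod, haar_I, ← ENNReal.ofReal_mul (by positivity)]

theorem haar₂_cubeSubgroup_ne_zero (n : ℕ) :
    haar₂ m (cubeSubgroup m n : Set (G m × G m)) ≠ 0 := by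
  rw [haar₂_cubeSubgroup]
  have : (0 : ℝ) < M m n := by exact_mod_cast M_pos m n
  exact (ENNReal.ofReal_pos.2 (by positivity)).ne'

theorem haar₂_cubeSubgroup_le {B : ℕ} (hB : ∀ k, m k ≤ B) (n : ℕ) :
    haar₂ m (cubeSubgroup m n : Set (G m × G m)) ≤
      ((B : ℝ≥0∞) * B) * haar₂ m (cubeSubgroup m (n + 1) : Set (G m × G m)) := by
  rw [haar₂_cubeSubgroup, haar₂_cubeSubgroup, ← ENNReal.ofReal_natCast (n := B),
    ← ENNReal.ofReal_mul (by positivity), ← ENNReal.ofReal_mul (by positivity)]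
  refine ENNReal.ofReal_le_ofReal ?_
  have h1 : (0 : ℝ) < M m n := by exact_mod_cast M_pos m n
  have h2 : (0 : ℝ) < m n := by exact_mod_cast Nat.pos_of_neZero (m n)
  have h3 : (m n : ℝ) ≤ B := by exact_mod_cast hB n
  have h4 : (M m (n + 1) : ℝ) = M m n * m n := by simp [M, Finset.prod_range_succ]
  have h5 : (M m n : ℝ)⁻¹ ≤ B * (M m (n + 1) : ℝ)⁻¹ := by
    rw [h4, mul_inv, mul_comm (B : ℝ), mul_assoc]
    refine le_mul_of_one_le_right (by positivity) ?_
    rw [inv_mul_eq_div, one_le_div h2]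
    exact h3
  calc (M m n : ℝ)⁻¹ * (M m n : ℝ)⁻¹
      ≤ (B * (M m (n + 1) : ℝ)⁻¹) * (B * (M m (n + 1) : ℝ)⁻¹) := by gcongr
    _ = _ := by ring

end Group

/-! ### The pieces of the kernel and their weighted maximal operator. -/

section MaximalOperator

/-- The indices of the pieces of the kernel of `V_n`: the four sums, the differences `k - q` and
`n - k`, and `τ`. -/
abbrev PieceIndex : Type := Fin 4 × ℕ × ℕ × ℕ

/-- The set over which the piece with index `i` and parameter `q` is an integral. -/
def pieceSet (m : ℕ → ℕ) : PieceIndex → ℕ → Set (G m × G m)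
  | (0, l, j, τ), q => (I (q + l) (Pi.single q (τ : ZMod (m q))) ×ˢ I (q + l) 0) ∩
      antiDiag m (q + l + 1) (q + l + j)
  | (1, l, j, τ), q => (I (q + l) 0 ×ˢ I (q + l) (Pi.single q (τ : ZMod (m q)))) ∩
      antiDiag m (q + l + 1) (q + l + j)
  | (2, l, j, τ), q => I (q + l + j) 0 ×ˢ I (q + l) (Pi.single q (τ : ZMod (m q)))
  | (3, l, j, τ), q => I (q + l) (Pi.single q (τ : ZMod (m q))) ×ˢ I (q + l + j) 0

/-- The centre of `pieceSet m i q`. -/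
def pieceShift (m : ℕ → ℕ) : PieceIndex → ℕ → G m × G m
  | (0, _, _, τ), q => (Pi.single q (τ : ZMod (m q)), 0)
  | (1, _, _, τ), q => (0, Pi.single q (τ : ZMod (m q)))
  | (2, _, _, τ), q => (0, Pi.single q (τ : ZMod (m q)))
  | (3, _, _, τ), q => (Pi.single q (τ : ZMod (m q)), 0)

/-- The total size of the parameters of a piece, which governs its weight. -/
def PieceIndex.size (i : PieceIndex) : ℕ := i.2.1 + i.2.2.1 + i.2.2.2

variable {m : ℕ → ℕ}

theorem add_mem_I {n k : ℕ} (hnk : n ≤ k) {x w v : G m} (hw : w ∈ I n x)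
    (hv : ∀ i < k, v i = 0) : w + v ∈ I n x := fun j hj => by
  simp [hw j hj, hv j (hj.trans_le hnk)]

theorem add_mem_antiDiag {a b : ℕ} {w v : G m × G m} (hw : w ∈ antiDiag m a b)
    (hv : v ∈ cubeSubgroup m b) : w + v ∈ antiDiag m a b := fun r ha hb => by
  simpa [hv.1 r hb, hv.2 r hb] using hw r ha hb

theorem sub_eq_zero_of_mem_I {n k : ℕ} (hnk : n ≤ k) {x w : G m} (hw : w ∈ I k x) :
    ∀ i < n, (w - x) i = 0 := fun i hi => by
  simp [hw i (hi.trans_le hnk)]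

theorem pieceShift_mem (i : PieceIndex) (q : ℕ) : pieceShift m i q ∈ cubeSubgroup m q := by
  obtain ⟨s, l, j, τ⟩ := i
  fin_cases s <;>
  exact ⟨fun r hr => by simp [pieceShift, Pi.single_eq_of_ne hr.ne],
    fun r hr => by simp [pieceShift, Pi.single_eq_of_ne hr.ne]⟩

theorem add_mem_pieceSet (l j τ : ℕ) (s : Fin 4) (q : ℕ) :
    ∀ w ∈ pieceSet m (s, l, j, τ) q, ∀ u ∈ cubeSubgroup m (q + l + j),
      w + u ∈ pieceSet m (s, l, j, τ) q := by
  have h : q + l ≤ q + l + j := Nat.le_add_right _ _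
  intro w hw u hu
  fin_cases s
  · exact ⟨⟨add_mem_I h hw.1.1 hu.1, add_mem_I h hw.1.2 hu.2⟩, add_mem_antiDiag hw.2 hu⟩
  · exact ⟨⟨add_mem_I h hw.1.1 hu.1, add_mem_I h hw.1.2 hu.2⟩, add_mem_antiDiag hw.2 hu⟩
  · exact ⟨add_mem_I le_rfl hw.1 hu.1, add_mem_I h hw.2 hu.2⟩
  · exact ⟨add_mem_I h hw.1 hu.1, add_mem_I le_rfl hw.2 hu.2⟩

theorem sub_pieceShift_mem (l j τ : ℕ) (s : Fin 4) (q : ℕ) :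
    ∀ w ∈ pieceSet m (s, l, j, τ) q,
      w - pieceShift m (s, l, j, τ) q ∈ cubeSubgroup m (q + l) := by
  have h : q + l ≤ q + l + j := Nat.le_add_right _ _
  intro w hw
  fin_cases s
  · exact ⟨sub_eq_zero_of_mem_I le_rfl hw.1.1, sub_eq_zero_of_mem_I le_rfl hw.1.2⟩
  · exact ⟨sub_eq_zero_of_mem_I le_rfl hw.1.1, sub_eq_zero_of_mem_I le_rfl hw.1.2⟩
  · exact ⟨sub_eq_zero_of_mem_I h hw.1, sub_eq_zero_of_mem_I le_rfl hw.2⟩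
  · exact ⟨sub_eq_zero_of_mem_I le_rfl hw.1, sub_eq_zero_of_mem_I h hw.2⟩

/-- The sum of the weights of the pieces, with a linear factor. -/
noncomputable def weightSum (ρ : ℝ≥0) : ℝ≥0∞ :=
  ∑' i : PieceIndex, (ρ : ℝ≥0∞) ^ i.size * (1 + i.size)

theorem weightSum_ne_top {ρ : ℝ≥0} (hρ : ρ < 1) : weightSum ρ ≠ ∞ := by
  have hF : ∑' n : ℕ, (ρ : ℝ≥0∞) ^ n * (1 + n) ≠ ∞ := by
    have h : ∀ n : ℕ, (ρ : ℝ≥0∞) ^ n * (1 + n) = ((ρ ^ n * (1 + n) : ℝ≥0) : ℝ≥0∞) := by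
      intro n
      push_cast
      rfl
    simp_rw [h]
    rw [ENNReal.tsum_coe_ne_top_iff_summable, ← NNReal.summable_coe]
    have hn : ‖(ρ : ℝ)‖ < 1 := by simpa using hρ
    have h1 := (summable_geometric_of_norm_lt_one hn).add
      (summable_pow_mul_geometric_of_norm_lt_one 1 hn)
    refine h1.congr fun n => ?_
    push_cast
    ring
  set F := ∑' n : ℕ, (ρ : ℝ≥0∞) ^ n * (1 + n) with hFdef
  have hle : weightSum ρ ≤ ∑' i : PieceIndex, ((ρ : ℝ≥0∞) ^ i.2.1 * (1 + i.2.1)) *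
      (((ρ : ℝ≥0∞) ^ i.2.2.1 * (1 + i.2.2.1)) * ((ρ : ℝ≥0∞) ^ i.2.2.2 * (1 + i.2.2.2))) := by
    refine ENNReal.tsum_le_tsum fun i => ?_
    obtain ⟨s, l, j, τ⟩ := i
    -- This makes the summand a product, so the series is bounded by 4 * F ^ 3.
    have h1 : (1 + (l + j + τ : ℕ) : ℝ≥0∞) ≤ (1 + l) * ((1 + j) * (1 + τ)) := by
      have : 1 + (l + j + τ) ≤ (1 + l) * ((1 + j) * (1 + τ)) := by
        nlinarith [Nat.zero_le (l * j), Nat.zero_le (j * τ), Nat.zero_le (l * τ),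
          Nat.zero_le (l * (j * τ))]
      exact_mod_cast this
    calc (ρ : ℝ≥0∞) ^ (l + j + τ) * (1 + (l + j + τ : ℕ))
        ≤ (ρ : ℝ≥0∞) ^ (l + j + τ) * ((1 + l) * ((1 + j) * (1 + τ))) := by gcongr
      _ = _ := by rw [pow_add, pow_add]; ring
  refine (hle.trans_lt ?_).ne
  rw [ENNReal.tsum_prod']
  simp_rw [ENNReal.tsum_prod', ENNReal.tsum_mul_left, ENNReal.tsum_mul_right, ← hFdef]
  rw [tsum_fintype]
  simp only [Finset.sum_const, nsmul_eq_mul]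
  finiteness

theorem weightSum_ne_zero {ρ : ℝ≥0} : weightSum ρ ≠ 0 := by
  refine (lt_of_lt_of_le one_pos ?_).ne'
  refine le_trans ?_ (ENNReal.le_tsum ((0, 0, 0, 0) : PieceIndex))
  simp [PieceIndex.size]

theorem tsum_pow_size_le (ρ : ℝ≥0) : ∑' i : PieceIndex, (ρ : ℝ≥0∞) ^ i.size ≤ weightSum ρ :=
  ENNReal.tsum_le_tsum fun _ => le_mul_of_one_le_right zero_le le_self_add

/-- The sum over the pieces of the maximal operators of their averages, with geometric weights. -/
noncomputable def pieceMaximal (m : ℕ → ℕ) (A ρ : ℝ≥0) (g : G m × G m → ℝ≥0∞)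
    (z : G m × G m) : ℝ≥0∞ :=
  ∑' i : PieceIndex, ((A : ℝ≥0∞) * (ρ : ℝ≥0∞) ^ (2 * i.size)) *
    ⨆ q, convAverage (haar₂ m) (pieceSet m i q) g z

theorem pieceMaximal_le_of_forall_le {A ρ : ℝ≥0} (hρ : ρ < 1) (g : G m × G m → ℝ≥0∞)
    (a : ℝ≥0∞) (hg : ∀ z, g z ≤ a) (z : G m × G m) :
    pieceMaximal m A ρ g z ≤ A * weightSum ρ * a := by
  calc pieceMaximal m A ρ g z ≤ ∑' i : PieceIndex, (A * (ρ : ℝ≥0∞) ^ i.size) * a := by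
        refine ENNReal.tsum_le_tsum fun i => ?_
        refine mul_le_mul' (mul_le_mul' le_rfl ?_)
          (iSup_le fun q => convAverage_le_of_forall_le hg z)
        exact pow_le_pow_right_of_le_one' (by exact_mod_cast hρ.le) (by omega)
    _ = A * (∑' i : PieceIndex, (ρ : ℝ≥0∞) ^ i.size) * a := by
        rw [ENNReal.tsum_mul_right, ENNReal.tsum_mul_left]
    _ ≤ _ := by gcongr; exact tsum_pow_size_le ρ

variable [∀ k, NeZero (m k)]

theorem measurableSet_pieceSet (i : PieceIndex) (q : ℕ) : MeasurableSet (pieceSet m i q) := by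
  obtain ⟨s, l, j, τ⟩ := i
  fin_cases s
  · exact ((measurableSet_I _ _).prod (measurableSet_I _ _)).inter (measurableSet_antiDiag _ _)
  · exact ((measurableSet_I _ _).prod (measurableSet_I _ _)).inter (measurableSet_antiDiag _ _)
  · exact (measurableSet_I _ _).prod (measurableSet_I _ _)
  · exact (measurableSet_I _ _).prod (measurableSet_I _ _)

theorem measurable_pieceMaximal (A ρ : ℝ≥0) {g : G m × G m → ℝ≥0∞} (hg : Measurable g) :
    Measurable (pieceMaximal m A ρ g) :=
  Measurable.tsum fun _ =>
    (Measurable.iSup fun _ => measurable_convAverage _ hg).const_mul _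

theorem pieceMaximal_add_le (A ρ : ℝ≥0) {g h : G m × G m → ℝ≥0∞} (hg : Measurable g)
    (z : G m × G m) : pieceMaximal m A ρ (fun z => g z + h z) z ≤
      pieceMaximal m A ρ g z + pieceMaximal m A ρ h z := by
  unfold pieceMaximal
  rw [← ENNReal.tsum_add]
  refine ENNReal.tsum_le_tsum fun i => ?_
  rw [← mul_add]
  refine mul_le_mul' le_rfl (iSup_le fun q => ?_)
  rw [convAverage_add hg]
  exact add_le_add (le_iSup (fun q => convAverage (haar₂ m) (pieceSet m i q) g z) q)
    (le_iSup (fun q => convAverage (haar₂ m) (pieceSet m i q) h z) q)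

/-- The constant in the weak type inequality for `pieceMaximal`. -/
noncomputable def weakConst (B : ℕ) (A ρ : ℝ≥0) : ℝ≥0∞ :=
  A * (B * B + 1) * weightSum ρ * weightSum ρ

/-- The linear growth 1 + l + j of the individual weak type constants is absorbed by the geometric
weights. -/
theorem mul_measure_pieceMaximal_gt_le {B : ℕ} (hB : ∀ k, m k ≤ B) {A ρ : ℝ≥0} (hA : A ≠ 0)
    (hρ0 : ρ ≠ 0) (hρ : ρ < 1) {g : G m × G m → ℝ≥0∞} (hg : Measurable g) (a : ℝ≥0∞) :
    a * haar₂ m {z | a < pieceMaximal m A ρ g z} ≤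
      weakConst B A ρ * ∫⁻ z, g z ∂(haar₂ m) := by
  have hB1 : 1 ≤ B := (Nat.pos_of_neZero (m 0)).trans_le (hB 0)
  have hD1 : (1 : ℝ≥0∞) ≤ (B : ℝ≥0∞) * B := by exact_mod_cast Nat.mul_le_mul hB1 hB1
  have hρe : (ρ : ℝ≥0∞) ≠ 0 := by exact_mod_cast hρ0
  have hAe : (A : ℝ≥0∞) ≠ 0 := by exact_mod_cast hA
  have hW0 := weightSum_ne_zero (ρ := ρ)
  have hWt := weightSum_ne_top hρ
  have h := mul_measure_tsum_gt_le (μ := haar₂ m) (D := (B : ℝ≥0∞) * B + 1)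
    (J := ∫⁻ z, g z ∂(haar₂ m))
    (h := fun (i : PieceIndex) z => ⨆ q, convAverage (haar₂ m) (pieceSet m i q) g z)
    (c := fun i => (A : ℝ≥0∞) * (ρ : ℝ≥0∞) ^ (2 * i.size))
    -- Of the decay ρ ^ (2 * size), one factor ρ ^ size pays for these weights, and the other makes
    -- the series of constants converge.
    (w := fun i => (ρ : ℝ≥0∞) ^ i.size / weightSum ρ)
    (K := fun i => 1 + i.size)
    (by positivity) (by finiteness) (fun i => mul_ne_zero hAe (pow_ne_zero _ hρe))
    (fun i => by finiteness) (fun i => ENNReal.div_ne_zero.2 ⟨pow_ne_zero _ hρe, hWt⟩)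
    (by
      simp_rw [div_eq_mul_inv]
      rw [ENNReal.tsum_mul_right, ← div_eq_mul_inv]
      exact ENNReal.div_le_of_le_mul (by simpa using tsum_pow_size_le ρ))
    (by
      intro i b
      obtain ⟨s, l, j, τ⟩ := i
      refine (mul_measure_iSup_convAverage_gt_le (U := cubeSubgroup m) hD1 antitone_cubeSubgroup
        measurableSet_cubeSubgroup cubeSubgroup_zero haar₂_cubeSubgroup_ne_zero
        (haar₂_cubeSubgroup_le hB) hg (l := l) (j := j) (fun q => pieceShift_mem (s, l, j, τ) q)
        (fun q => measurableSet_pieceSet (s, l, j, τ) q)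
        (fun q => add_mem_pieceSet l j τ s q) (fun q => sub_pieceShift_mem l j τ s q) b).trans ?_
      refine mul_le_mul' ?_ le_rfl
      have : (1 + l + j : ℝ≥0∞) = ((1 + l + j : ℕ) : ℝ≥0∞) := by push_cast; rfl
      rw [this]
      have h2 : 1 + l + j ≤ 1 + PieceIndex.size (s, l, j, τ) := by
        simp only [PieceIndex.size]
        omega
      exact_mod_cast h2) a
  refine h.trans (le_of_eq ?_)
  congr 1
  have hterm : ∀ i : PieceIndex, (A : ℝ≥0∞) * (ρ : ℝ≥0∞) ^ (2 * i.size) * ((B : ℝ≥0∞) * B + 1) /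
      ((ρ : ℝ≥0∞) ^ i.size / weightSum ρ) * (1 + i.size) =
      (A * (B * B + 1) * weightSum ρ) * ((ρ : ℝ≥0∞) ^ i.size * (1 + i.size)) := by
    intro i
    have hp0 : (ρ : ℝ≥0∞) ^ i.size ≠ 0 := pow_ne_zero _ hρe
    have hpt : (ρ : ℝ≥0∞) ^ i.size ≠ ∞ := by finiteness
    rw [two_mul, pow_add, div_eq_mul_inv,
      ENNReal.inv_div (Or.inl hWt) (Or.inl hW0), div_eq_mul_inv]
    calc _ = A * (B * B + 1) * weightSum ρ *
        (((ρ : ℝ≥0∞) ^ i.size * ((ρ : ℝ≥0∞) ^ i.size)⁻¹) * (ρ : ℝ≥0∞) ^ i.size *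
          (1 + i.size)) := by ring
      _ = _ := by rw [ENNReal.mul_inv_cancel hp0 hpt, one_mul]
  simp_rw [hterm]
  rw [ENNReal.tsum_mul_left]
  rfl

theorem weakConst_ne_top (B : ℕ) (A : ℝ≥0) {ρ : ℝ≥0} (hρ : ρ < 1) : weakConst B A ρ ≠ ∞ := by
  have := weightSum_ne_top hρ
  unfold weakConst
  finiteness

/-- The constant in the `L^s` inequality for `pieceMaximal`. -/
noncomputable def strongConst (B : ℕ) (A ρ : ℝ≥0) (s : ℝ) : ℝ≥0∞ :=
  (2 * (A * weightSum ρ)) ^ s * (ENNReal.ofReal s * (weakConst B A ρ / (A * weightSum ρ)) *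
    (ENNReal.ofReal (s - 1))⁻¹)

theorem strongConst_ne_top (B : ℕ) {A ρ : ℝ≥0} (hA : A ≠ 0) (hρ : ρ < 1) {s : ℝ} (hs : 1 < s) :
    strongConst B A ρ s ≠ ∞ := by
  have h1 := weightSum_ne_top hρ
  have h2 := weakConst_ne_top B A hρ
  have h3 : (A : ℝ≥0∞) * weightSum ρ ≠ 0 :=
    mul_ne_zero (by exact_mod_cast hA) weightSum_ne_zero
  have h4 : ENNReal.ofReal (s - 1) ≠ 0 := (ENNReal.ofReal_pos.2 (sub_pos.2 hs)).ne'
  have h5 : weakConst B A ρ / (A * weightSum ρ) ≠ ∞ := ENNReal.div_ne_top h2 h3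
  have h6 : (ENNReal.ofReal (s - 1))⁻¹ ≠ ∞ := ENNReal.inv_ne_top.2 h4
  have h7 : (2 * ((A : ℝ≥0∞) * weightSum ρ)) ^ s ≠ ∞ :=
    ENNReal.rpow_ne_top_of_nonneg (by linarith) (by finiteness)
  unfold strongConst
  finiteness

theorem lintegral_pieceMaximal_rpow_le {B : ℕ} (hB : ∀ k, m k ≤ B) {A ρ : ℝ≥0} (hA : A ≠ 0)
    (hρ0 : ρ ≠ 0) (hρ : ρ < 1) {s : ℝ} (hs : 1 < s) {g : G m × G m → ℝ≥0∞} (hg : Measurable g) :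
    ∫⁻ z, pieceMaximal m A ρ g z ^ s ∂(haar₂ m) ≤
      strongConst B A ρ s * ∫⁻ z, g z ^ s ∂(haar₂ m) := by
  have h1 := weightSum_ne_top hρ
  exact lintegral_rpow_le_of_weakType (T := pieceMaximal m A ρ)
    (fun g hg => measurable_pieceMaximal A ρ hg)
    (fun g h hg _ z => pieceMaximal_add_le A ρ hg z)
    (mul_ne_zero (by exact_mod_cast hA) weightSum_ne_zero) (by finiteness)
    (pieceMaximal_le_of_forall_le hρ)
    (fun g hg a => mul_measure_pieceMaximal_gt_le hB hA hρ0 hρ hg a) hs hg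

end MaximalOperator

/-! ### Pointwise domination of powers of V_n by the maximal operators of the pieces. -/

section Pointwise

theorem rpow_sum_le_sum_rpow {ι : Type*} (s : Finset ι) (f : ι → ℝ≥0∞) {r : ℝ} (hr0 : 0 < r)
    (hr1 : r ≤ 1) : (∑ i ∈ s, f i) ^ r ≤ ∑ i ∈ s, f i ^ r := by
  classical
  induction s using Finset.induction_on with
  | empty => simp [hr0]
  | insert a s ha ih =>
    rw [Finset.sum_insert ha, Finset.sum_insert ha]
    exact (ENNReal.rpow_add_le_add_rpow _ _ hr0.le hr1).trans (by gcongr)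

theorem enorm_sum_rpow_le {ι : Type*} (s : Finset ι) (f : ι → ℂ) {r : ℝ} (hr0 : 0 < r)
    (hr1 : r ≤ 1) : ‖∑ i ∈ s, f i‖ₑ ^ r ≤ ∑ i ∈ s, ‖f i‖ₑ ^ r :=
  (ENNReal.rpow_le_rpow (enorm_sum_le _ _) hr0.le).trans (rpow_sum_le_sum_rpow s _ hr0 hr1)

/-- For functions that are constant on the cosets of `U`, the integral over a union of cosets
is controlled by the integral of a power with exponent at most one. -/
theorem lintegral_rpow_le_of_const_on_cosets {X : Type*} [AddCommGroup X] [MeasurableSpace X]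
    [MeasurableAdd₂ X] {μ : Measure X} [IsProbabilityMeasure μ]
    [μ.IsAddLeftInvariant] {U : AddSubgroup X} (hU : MeasurableSet (U : Set X))
    (hU0 : μ (U : Set X) ≠ 0) {h : X → ℝ≥0∞} (hh : ∀ z, ∀ v ∈ U, h (z - v) = h z)
    {S : Set X} (hS : MeasurableSet S) (hSU : ∀ w ∈ S, ∀ u ∈ U, w + u ∈ S) {r : ℝ} (hr0 : 0 < r)
    (hr1 : r ≤ 1) (z : X) :
    (∫⁻ w in S, h (z - w) ∂μ) ^ r ≤ μ (U : Set X) ^ (r - 1) * ∫⁻ w in S, h (z - w) ^ r ∂μ := by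
  set u := μ (U : Set X) with hu
  have hut : u ≠ ∞ := measure_ne_top _ _
  set J := ∫⁻ w in S, h (z - w) ^ r ∂μ with hJ
  by_cases hJt : J = ∞
  · rw [hJt, ENNReal.mul_top]
    · exact le_top
    · exact (ENNReal.rpow_pos (pos_iff_ne_zero.2 hU0) hut).ne'
  -- One coset of U inside S already carries the value at w₀ on mass u. This sup bound is used below
  -- to write h = h^r * h^{1-r} and estimate the second factor.
  have hsup : ∀ w₀ ∈ S, h (z - w₀) ^ r ≤ J / u := by
    intro w₀ hw₀
    rw [ENNReal.le_div_iff_mul_le (Or.inl hU0) (Or.inl hut), ← setLIntegral_const,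
      ← lintegral_indicator hU, hJ, ← lintegral_indicator hS,
      ← lintegral_add_left_eq_self (S.indicator fun w => h (z - w) ^ r) w₀]
    refine lintegral_mono fun w => Set.indicator_apply_le' (fun hw => ?_) fun _ => zero_le
    rw [Set.indicator_of_mem (hSU w₀ hw₀ w hw), ← sub_sub, hh _ w hw]
  have hq : 0 ≤ (1 - r) / r := div_nonneg (sub_nonneg.2 hr1) hr0.le
  have hpt : ∀ w ∈ S, h (z - w) ≤ h (z - w) ^ r * (J / u) ^ ((1 - r) / r) := by
    intro w hw
    calc h (z - w) = h (z - w) ^ (r + (1 - r)) := by rw [add_sub_cancel, ENNReal.rpow_one]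
      _ = h (z - w) ^ r * (h (z - w) ^ r) ^ ((1 - r) / r) := by
          rw [ENNReal.rpow_add_of_nonneg _ _ hr0.le (sub_nonneg.2 hr1), ← ENNReal.rpow_mul,
            mul_div_cancel₀ _ hr0.ne']
      _ ≤ _ := by
          gcongr
          exact hsup w hw
  have hc : (J / u) ^ ((1 - r) / r) ≠ ∞ :=
    ENNReal.rpow_ne_top_of_nonneg hq (ENNReal.div_ne_top hJt hU0)
  calc (∫⁻ w in S, h (z - w) ∂μ) ^ r ≤ (J * (J / u) ^ ((1 - r) / r)) ^ r := by
        gcongr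
        rw [hJ, ← lintegral_mul_const' _ _ hc]
        exact setLIntegral_mono' hS hpt
    _ = u ^ (r - 1) * J := by
        rw [ENNReal.mul_rpow_of_nonneg _ _ hr0.le, ← ENNReal.rpow_mul,
          div_mul_cancel₀ _ hr0.ne', ENNReal.div_rpow_of_nonneg _ _ (sub_nonneg.2 hr1),
          div_eq_mul_inv, ← ENNReal.rpow_neg, neg_sub, ← mul_assoc,
          ← ENNReal.rpow_add_of_nonneg _ _ hr0.le (sub_nonneg.2 hr1), add_sub_cancel,
          ENNReal.rpow_one, mul_comm]

/-- With Q = M_q, K = M_k, N = M_n the left side is d^{1-r} (Q/K)^r (K/N)^{2r-1}. The last exponent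
is positive exactly when r > 1/2, and r ≥ 2r - 1 since r ≤ 1. -/
theorem coefficient_bound {Q K N d B r : ℝ} {l j : ℕ} (hQ : 0 < Q) (hQK : 2 ^ l * Q ≤ K)
    (hKN : 2 ^ j * K ≤ N) (hd : 1 ≤ d) (hdB : d ≤ B) (hr : 1 / 2 < r) (hr1 : r ≤ 1) :
    (Q * K / d) ^ r * (N⁻¹ * N⁻¹) ^ (r - 1) * (d / (K * N)) ≤
      B * ((2 : ℝ) ^ (1 - 2 * r)) ^ (l + j) := by
  have hK : 0 < K := lt_of_lt_of_le (by positivity) hQK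
  have hN : 0 < N := lt_of_lt_of_le (by positivity) hKN
  have hB : 0 < B := by linarith
  have h1 : l * Real.log 2 + Real.log Q ≤ Real.log K := by
    rw [← Real.log_pow, ← Real.log_mul (by positivity) hQ.ne']
    exact Real.log_le_log (by positivity) hQK
  have h2 : j * Real.log 2 + Real.log K ≤ Real.log N := by
    rw [← Real.log_pow, ← Real.log_mul (by positivity) hK.ne']
    exact Real.log_le_log (by positivity) hKN
  have h3 : 0 ≤ Real.log d := Real.log_nonneg hd
  have h4 : Real.log d ≤ Real.log B := Real.log_le_log (by linarith) hdB
  have h5 : 0 < Real.log 2 := Real.log_pos (by norm_num)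
  have hd0 : 0 < d := by linarith
  rw [← Real.log_le_log_iff (by positivity) (by positivity),
    Real.log_mul (by positivity) (by positivity), Real.log_mul (by positivity) (by positivity),
    Real.log_rpow (by positivity), Real.log_rpow (by positivity),
    Real.log_div (by positivity) (by positivity), Real.log_mul (by positivity) (by positivity),
    Real.log_mul (by positivity) (by positivity), Real.log_inv,
    Real.log_div (by positivity) (by positivity), Real.log_mul (by positivity) (by positivity),
    Real.log_mul (by positivity) (by positivity), Real.log_pow, Real.log_rpow (by norm_num)]
  push_cast
  -- The difference of the logarithms of the two sides is the sum of the four quantities below and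
  -- log B - log d.
  have e1 : 0 ≤ (Real.log K - Real.log Q - l * Real.log 2) * r :=
    mul_nonneg (by linarith) (by linarith)
  have e2 : 0 ≤ (Real.log N - Real.log K - j * Real.log 2) * (2 * r - 1) :=
    mul_nonneg (by linarith) (by linarith)
  have e3 : 0 ≤ Real.log d * r := mul_nonneg h3 (by linarith)
  have e4 : 0 ≤ (l * Real.log 2) * (1 - r) :=
    mul_nonneg (by positivity) (by linarith)
  linarith

/-- The square root of the decay rate of the weights of the pieces. -/
noncomputable def rate (r : ℝ) : ℝ≥0 := (2 : ℝ≥0) ^ ((1 - 2 * r) / 2)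

/-- The factor in front of the weights of the pieces. -/
noncomputable def amplitude (B : ℕ) (r : ℝ) : ℝ≥0 := (B + 1) / rate r ^ (2 * B)

theorem rate_ne_zero (r : ℝ) : rate r ≠ 0 := (NNReal.rpow_pos (by norm_num)).ne'

theorem rate_lt_one {r : ℝ} (hr : 1 / 2 < r) : rate r < 1 :=
  NNReal.rpow_lt_one_of_one_lt_of_neg (by norm_num) (by linarith)

theorem amplitude_ne_zero (B : ℕ) (r : ℝ) : amplitude B r ≠ 0 :=
  div_ne_zero (by positivity) (pow_ne_zero _ (rate_ne_zero r))

theorem coe_rate_sq (r : ℝ) : (rate r : ℝ) ^ 2 = (2 : ℝ) ^ (1 - 2 * r) := by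
  unfold rate
  rw [NNReal.coe_rpow, ← Real.rpow_natCast, ← Real.rpow_mul (by positivity)]
  congr 1
  push_cast
  ring

/-- There is no real decay in τ. As τ ≤ B, the artificial factor in τ, which lets the weights be
summed over all τ independently of m, is paid for by the denominator of `amplitude`. -/
theorem ofReal_le_amplitude_mul {B l j τ : ℕ} {r : ℝ} (hr : 1 / 2 < r) (hτ : τ ≤ B) :
    ENNReal.ofReal (B * ((2 : ℝ) ^ (1 - 2 * r)) ^ (l + j)) ≤
      (amplitude B r : ℝ≥0∞) * (rate r : ℝ≥0∞) ^ (2 * (l + j + τ)) := by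
  have h0 := rate_ne_zero r
  have h1 := (rate_lt_one hr).le
  rw [← coe_rate_sq, ← ENNReal.coe_pow, ← ENNReal.coe_mul, ← ENNReal.ofReal_coe_nnreal]
  refine ENNReal.ofReal_le_ofReal ?_
  have h2 : (B : ℝ≥0) * (rate r ^ 2) ^ (l + j) ≤ amplitude B r * rate r ^ (2 * (l + j + τ)) := by
    unfold amplitude
    rw [div_mul_eq_mul_div, le_div_iff₀ (by positivity), mul_assoc, ← pow_mul, ← pow_add]
    refine mul_le_mul' le_self_add (pow_le_pow_right_of_le_one' h1 (by omega))
  exact_mod_cast h2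

variable {m : ℕ → ℕ}

theorem two_pow_mul_M_le (hm : ∀ k, 2 ≤ m k) (q l : ℕ) :
    (2 : ℝ) ^ l * (M m q : ℝ) ≤ (M m (q + l) : ℝ) := by
  induction l with
  | zero => simp
  | succ l ih =>
    have h1 : (M m (q + (l + 1)) : ℝ) = M m (q + l) * m (q + l) := by
      rw [← add_assoc]
      simp [M, Finset.prod_range_succ]
    have h2 : (2 : ℝ) ≤ m (q + l) := by exact_mod_cast hm _
    rw [h1, pow_succ]
    calc (2 : ℝ) ^ l * 2 * M m q = (2 ^ l * M m q) * 2 := by ring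
      _ ≤ M m (q + l) * m (q + l) := by gcongr

/-- Summation over the parameters of one of the four sums in `V_n`. -/
theorem sum_sum_sum_le_tsum (n : ℕ) (s : Finset ℕ) (t u : ℕ → Finset ℕ)
    (ht : ∀ q ∈ s, ∀ k ∈ t q, q ≤ k ∧ k ≤ n) (Φ : ℕ × ℕ × ℕ → ℝ≥0∞) :
    ∑ q ∈ s, ∑ k ∈ t q, ∑ τ ∈ u q, Φ (k - q, n - k, τ) ≤ ∑' x, Φ x := by
  -- For fixed n the two differences determine k and then q; the bounds q ≤ k ≤ n make the truncated
  -- subtraction harmless.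
  have hinj : Set.InjOn (fun x : Σ _ : ℕ, ℕ => (x.2 - x.1, n - x.2)) (s.sigma t) := by
    rintro ⟨q, k⟩ hx ⟨q', k'⟩ hy h
    have hx' := Finset.mem_sigma.1 hx
    have hy' := Finset.mem_sigma.1 hy
    have h1 := ht q hx'.1 k hx'.2
    have h2 := ht q' hy'.1 k' hy'.2
    simp only [Prod.mk.injEq] at h
    obtain rfl : k = k' := by omega
    obtain rfl : q = q' := by omega
    rfl
  calc ∑ q ∈ s, ∑ k ∈ t q, ∑ τ ∈ u q, Φ (k - q, n - k, τ)
      ≤ ∑ q ∈ s, ∑ k ∈ t q, ∑' τ, Φ (k - q, n - k, τ) := by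
        gcongr
        exact ENNReal.sum_le_tsum _
    _ = ∑ x ∈ s.sigma t, ∑' τ, Φ (x.2 - x.1, n - x.2, τ) := Finset.sum_sigma' _ _ _
    _ = ∑ y ∈ (s.sigma t).image fun x => (x.2 - x.1, n - x.2), ∑' τ, Φ (y.1, y.2, τ) :=
        (Finset.sum_image (f := fun y : ℕ × ℕ => ∑' τ, Φ (y.1, y.2, τ)) hinj).symm
    _ ≤ ∑' y : ℕ × ℕ, ∑' τ, Φ (y.1, y.2, τ) := ENNReal.sum_le_tsum _
    _ = ∑' x, Φ x := by
        rw [ENNReal.tsum_prod', ENNReal.tsum_prod']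
        refine tsum_congr fun l => ?_
        rw [ENNReal.tsum_prod']

variable [∀ k, NeZero (m k)]

/-- The hypothesis under which the pieces of `V_n f` are controlled by the averages of `g`. -/
def PowerDominates (n : ℕ) (r : ℝ) (f : G m × G m → ℂ) (g : G m × G m → ℝ≥0∞) : Prop :=
  ∀ S : Set (G m × G m), MeasurableSet S → (∀ w ∈ S, ∀ u ∈ cubeSubgroup m n, w + u ∈ S) →
    ∀ z, (∫⁻ w in S, ‖f (z - w)‖ₑ ∂(haar₂ m)) ^ r ≤
      haar₂ m (cubeSubgroup m n : Set (G m × G m)) ^ (r - 1) * ∫⁻ w in S, g (z - w) ∂(haar₂ m)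

/-- The weighted maximal operator of one piece. -/
noncomputable def pieceTerm (m : ℕ → ℕ) (B : ℕ) (r : ℝ) (g : G m × G m → ℝ≥0∞) (z : G m × G m)
    (i : PieceIndex) : ℝ≥0∞ :=
  ((amplitude B r : ℝ≥0∞) * (rate r : ℝ≥0∞) ^ (2 * i.size)) *
    ⨆ q, convAverage (haar₂ m) (pieceSet m i q) g z

/-- One estimate for all four sums: d is m_k in the first two and 1 in the last two. -/
theorem rpow_coeff_mul_lintegral_le {B : ℕ} (hm : ∀ k, 2 ≤ m k) {r : ℝ}
    (hr : 1 / 2 < r) (hr1 : r ≤ 1) {q k n τ : ℕ} (hqk : q ≤ k) (hkn : k ≤ n) (hτ : τ ≤ B)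
    {f : G m × G m → ℂ} {g : G m × G m → ℝ≥0∞} (hfg : PowerDominates n r f g) {s : Fin 4}
    {d : ℝ} (hd : 1 ≤ d) (hdB : d ≤ B)
    (hS : haar₂ m (pieceSet m (s, k - q, n - k, τ) q) ≤
      ENNReal.ofReal (d / (M m k * M m n))) (z : G m × G m) :
    (ENNReal.ofReal (M m q * M m k / d) *
      ∫⁻ w in pieceSet m (s, k - q, n - k, τ) q, ‖f (z - w)‖ₑ ∂(haar₂ m)) ^ r ≤
      pieceTerm m B r g z (s, k - q, n - k, τ) := by
  obtain ⟨l, rfl⟩ := Nat.exists_eq_add_of_le hqk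
  obtain ⟨j, rfl⟩ := Nat.exists_eq_add_of_le hkn
  simp only [Nat.add_sub_cancel_left] at hS ⊢
  set S := pieceSet m (s, l, j, τ) q with hSdef
  have hr0 : 0 < r := by linarith
  have hQ : (0 : ℝ) < M m q := by exact_mod_cast M_pos m q
  have hK : (0 : ℝ) < M m (q + l) := by exact_mod_cast M_pos m _
  have hN : (0 : ℝ) < M m (q + l + j) := by exact_mod_cast M_pos m _
  have hd0 : 0 < d := by linarith
  have havg : ∫⁻ w in S, g (z - w) ∂(haar₂ m) ≤
      haar₂ m S * ⨆ q, convAverage (haar₂ m) (pieceSet m (s, l, j, τ) q) g z := by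
    -- Only upper bounds for the measures of the pieces are at hand, so the null case is treated
    -- separately.
    rcases eq_or_ne (haar₂ m S) 0 with h0 | h0
    · rw [Measure.restrict_eq_zero.2 h0]
      simp
    · calc ∫⁻ w in S, g (z - w) ∂(haar₂ m) = haar₂ m S * convAverage (haar₂ m) S g z := by
            unfold convAverage
            rw [← mul_assoc, ENNReal.mul_inv_cancel h0 (measure_ne_top _ _), one_mul]
        _ ≤ _ := by
            gcongr
            exact le_iSup (fun q => convAverage (haar₂ m) (pieceSet m (s, l, j, τ) q) g z) q
  rw [ENNReal.mul_rpow_of_nonneg _ _ hr0.le, ENNReal.ofReal_rpow_of_pos (by positivity)]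
  have h1 := hfg S (measurableSet_pieceSet _ _) (add_mem_pieceSet l j τ s q) z
  rw [haar₂_cubeSubgroup, ENNReal.ofReal_rpow_of_pos (by positivity)] at h1
  refine (mul_le_mul' le_rfl (h1.trans (mul_le_mul' le_rfl
    (havg.trans (mul_le_mul' hS le_rfl))))).trans ?_
  rw [← mul_assoc, ← mul_assoc, ← ENNReal.ofReal_mul (by positivity),
    ← ENNReal.ofReal_mul (by positivity)]
  refine mul_le_mul' (le_trans (ENNReal.ofReal_le_ofReal ?_)
    (ofReal_le_amplitude_mul hr hτ)) le_rfl
  exact coefficient_bound hQ (two_pow_mul_M_le hm q l) (two_pow_mul_M_le hm (q + l) j) hd hdB hr hr1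

theorem enorm_setIntegral_mul_indicator_le (f : G m × G m → ℂ) (R : Set (G m × G m)) (a b : ℕ)
    (z : G m × G m) :
    ‖∫ w in R, f (z.1 - w.1, z.2 - w.2) * (antiDiag m a b).indicator 1 w ∂(haar₂ m)‖ₑ ≤
      ∫⁻ w in R ∩ antiDiag m a b, ‖f (z - w)‖ₑ ∂(haar₂ m) := by
  refine (enorm_integral_le_lintegral_enorm _).trans ?_
  rw [Set.inter_comm, ← setLIntegral_indicator (measurableSet_antiDiag a b)]
  refine lintegral_mono fun w => ?_
  by_cases hw : w ∈ antiDiag m a b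
  · simp only [Set.indicator_of_mem hw, Pi.one_apply, mul_one]
    exact le_rfl
  · simp [Set.indicator_of_notMem hw]

theorem haar₂_swap_preimage {S : Set (G m × G m)} (hS : MeasurableSet S) :
    haar₂ m (Prod.swap ⁻¹' S) = haar₂ m S := by
  rw [← Measure.map_apply measurable_swap hS]
  unfold haar₂
  rw [Measure.prod_swap]

theorem enorm_nat_coeff (a b c : ℕ) :
    ‖(a : ℂ) * (b : ℂ) / (c : ℂ)‖ₑ = ENNReal.ofReal ((a : ℝ) * b / c) := by
  rw [← ofReal_norm]
  simp

theorem haar₂_pieceSet_one_le {q k n τ : ℕ} (hqk : q ≤ k) (hkn : k < n) :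
    haar₂ m (pieceSet m (1, k - q, n - k, τ) q) ≤
      ENNReal.ofReal ((m k : ℝ) / (M m k * M m n)) := by
  -- Interchanging t and u reduces this to the first kind of piece, the antidiagonal condition being
  -- symmetric.
  rw [← haar₂_swap_preimage (measurableSet_pieceSet _ _)]
  refine le_trans (measure_mono ?_)
    (haar₂_prod_inter_antiDiag_le hkn (Pi.single q (τ : ZMod (m q))))
  rintro ⟨t, u⟩ ⟨⟨h1, h2⟩, h3⟩
  rw [show q + (k - q) = k by omega] at h1 h2
  rw [show q + (k - q) + 1 = k + 1 by omega, show q + (k - q) + (n - k) = n by omega] at h3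
  exact ⟨⟨h2, h1⟩, fun r ha hb => (add_comm _ _).trans (h3 r ha hb)⟩

theorem haar₂_I_prod_I (a b : ℕ) (x y : G m) :
    haar₂ m (I a x ×ˢ I b y) = ENNReal.ofReal ((M m a : ℝ)⁻¹ * (M m b : ℝ)⁻¹) := by
  unfold haar₂
  rw [Measure.prod_prod, haar_I, haar_I, ← ENNReal.ofReal_mul (by positivity)]

variable {B : ℕ} {r : ℝ} {n : ℕ} {f : G m × G m → ℂ} {g : G m × G m → ℝ≥0∞}

theorem enorm_V₁_rpow_le (hm : ∀ k, 2 ≤ m k) (hB : ∀ k, m k ≤ B) (hr : 1 / 2 < r) (hr1 : r ≤ 1)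
    (hfg : PowerDominates n r f g) (z : G m × G m) :
    ‖V₁ n f z‖ₑ ^ r ≤ ∑' x : ℕ × ℕ × ℕ, pieceTerm m B r g z (0, x) := by
  have hr0 : 0 < r := by linarith
  refine le_trans ?_ (sum_sum_sum_le_tsum n (Finset.range n) (fun q => Finset.Ico q n)
    (fun q => Finset.Ico 1 (m q)) (fun q _ k hk => by
      have := Finset.mem_Ico.1 hk
      omega) _)
  unfold V₁
  refine (enorm_sum_rpow_le _ _ hr0 hr1).trans (Finset.sum_le_sum fun q _ => ?_)
  refine (enorm_sum_rpow_le _ _ hr0 hr1).trans (Finset.sum_le_sum fun k hk => ?_)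
  refine (enorm_sum_rpow_le _ _ hr0 hr1).trans (Finset.sum_le_sum fun τ hτ => ?_)
  obtain ⟨hqk, hkn⟩ := Finset.mem_Ico.1 hk
  have hτB : τ ≤ B := ((Finset.mem_Ico.1 hτ).2.le).trans (hB q)
  have hset : pieceSet m (0, k - q, n - k, τ) q =
      (I k (Pi.single q (τ : ZMod (m q))) ×ˢ I k 0) ∩ antiDiag m (k + 1) n := by
    simp only [pieceSet]
    rw [show q + (k - q) = k by omega, show k + (n - k) = n by omega]
  refine le_trans ?_ (rpow_coeff_mul_lintegral_le hm hr hr1 hqk hkn.le hτB hfg (d := m k)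
    (by exact_mod_cast (hm k).trans' one_le_two) (by exact_mod_cast hB k)
    (hset ▸ haar₂_prod_inter_antiDiag_le hkn _) z)
  rw [enorm_mul, enorm_nat_coeff, hset]
  gcongr
  exact enorm_setIntegral_mul_indicator_le _ _ _ _ _

theorem enorm_V₂_rpow_le (hm : ∀ k, 2 ≤ m k) (hB : ∀ k, m k ≤ B) (hr : 1 / 2 < r) (hr1 : r ≤ 1)
    (hfg : PowerDominates n r f g) (z : G m × G m) :
    ‖V₂ n f z‖ₑ ^ r ≤ ∑' x : ℕ × ℕ × ℕ, pieceTerm m B r g z (1, x) := by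
  have hr0 : 0 < r := by linarith
  refine le_trans ?_ (sum_sum_sum_le_tsum n (Finset.range n) (fun q => Finset.Ico q n)
    (fun q => Finset.Ico 1 (m q)) (fun q _ k hk => by
      have := Finset.mem_Ico.1 hk
      omega) _)
  unfold V₂
  refine (enorm_sum_rpow_le _ _ hr0 hr1).trans (Finset.sum_le_sum fun q _ => ?_)
  refine (enorm_sum_rpow_le _ _ hr0 hr1).trans (Finset.sum_le_sum fun k hk => ?_)
  refine (enorm_sum_rpow_le _ _ hr0 hr1).trans (Finset.sum_le_sum fun τ hτ => ?_)
  obtain ⟨hqk, hkn⟩ := Finset.mem_Ico.1 hk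
  have hτB : τ ≤ B := ((Finset.mem_Ico.1 hτ).2.le).trans (hB q)
  have hset : pieceSet m (1, k - q, n - k, τ) q =
      (I k 0 ×ˢ I k (Pi.single q (τ : ZMod (m q)))) ∩ antiDiag m (k + 1) n := by
    simp only [pieceSet]
    rw [show q + (k - q) = k by omega, show k + (n - k) = n by omega]
  refine le_trans ?_ (rpow_coeff_mul_lintegral_le hm hr hr1 hqk hkn.le hτB hfg (d := m k)
    (by exact_mod_cast (hm k).trans' one_le_two) (by exact_mod_cast hB k)
    (haar₂_pieceSet_one_le hqk hkn) z)
  rw [enorm_mul, enorm_nat_coeff, hset]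
  gcongr
  exact enorm_setIntegral_mul_indicator_le _ _ _ _ _

theorem enorm_V₃_rpow_le (hm : ∀ k, 2 ≤ m k) (hB : ∀ k, m k ≤ B) (hr : 1 / 2 < r) (hr1 : r ≤ 1)
    (hfg : PowerDominates n r f g) (z : G m × G m) :
    ‖V₃ n f z‖ₑ ^ r ≤ ∑' x : ℕ × ℕ × ℕ, pieceTerm m B r g z (2, x) := by
  have hr0 : 0 < r := by linarith
  have hB1 : (1 : ℝ) ≤ B := by exact_mod_cast ((hm 0).trans' one_le_two).trans (hB 0)
  refine le_trans ?_ (sum_sum_sum_le_tsum n (Finset.range (n + 1)) (fun q => Finset.Icc q n)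
    (fun q => Finset.Ico 1 (m q)) (fun q _ k hk => Finset.mem_Icc.1 hk) _)
  unfold V₃
  refine (enorm_sum_rpow_le _ _ hr0 hr1).trans (Finset.sum_le_sum fun q _ => ?_)
  refine (enorm_sum_rpow_le _ _ hr0 hr1).trans (Finset.sum_le_sum fun k hk => ?_)
  refine (enorm_sum_rpow_le _ _ hr0 hr1).trans (Finset.sum_le_sum fun τ hτ => ?_)
  obtain ⟨hqk, hkn⟩ := Finset.mem_Icc.1 hk
  have hτB : τ ≤ B := ((Finset.mem_Ico.1 hτ).2.le).trans (hB q)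
  have hset : pieceSet m (2, k - q, n - k, τ) q =
      I n 0 ×ˢ I k (Pi.single q (τ : ZMod (m q))) := by
    simp only [pieceSet]
    rw [show q + (k - q) = k by omega, show k + (n - k) = n by omega]
  refine le_trans ?_ (rpow_coeff_mul_lintegral_le hm hr hr1 hqk hkn hτB hfg (d := 1)
    le_rfl hB1 (by
      rw [hset, haar₂_I_prod_I, one_div, mul_inv, mul_comm]) z)
  rw [enorm_mul, hset]
  have hc := enorm_nat_coeff (M m q) (M m k) 1
  rw [Nat.cast_one, Nat.cast_one, div_one] at hc
  rw [hc]
  gcongr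
  exact enorm_integral_le_lintegral_enorm _

theorem enorm_V₄_rpow_le (hm : ∀ k, 2 ≤ m k) (hB : ∀ k, m k ≤ B) (hr : 1 / 2 < r) (hr1 : r ≤ 1)
    (hfg : PowerDominates n r f g) (z : G m × G m) :
    ‖V₄ n f z‖ₑ ^ r ≤ ∑' x : ℕ × ℕ × ℕ, pieceTerm m B r g z (3, x) := by
  have hr0 : 0 < r := by linarith
  have hB1 : (1 : ℝ) ≤ B := by exact_mod_cast ((hm 0).trans' one_le_two).trans (hB 0)
  refine le_trans ?_ (sum_sum_sum_le_tsum n (Finset.range (n + 1)) (fun q => Finset.Icc q n)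
    (fun q => Finset.Ico 1 (m q)) (fun q _ k hk => Finset.mem_Icc.1 hk) _)
  unfold V₄
  refine (enorm_sum_rpow_le _ _ hr0 hr1).trans (Finset.sum_le_sum fun q _ => ?_)
  refine (enorm_sum_rpow_le _ _ hr0 hr1).trans (Finset.sum_le_sum fun k hk => ?_)
  refine (enorm_sum_rpow_le _ _ hr0 hr1).trans (Finset.sum_le_sum fun τ hτ => ?_)
  obtain ⟨hqk, hkn⟩ := Finset.mem_Icc.1 hk
  have hτB : τ ≤ B := ((Finset.mem_Ico.1 hτ).2.le).trans (hB q)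
  have hset : pieceSet m (3, k - q, n - k, τ) q =
      I k (Pi.single q (τ : ZMod (m q))) ×ˢ I n 0 := by
    simp only [pieceSet]
    rw [show q + (k - q) = k by omega, show k + (n - k) = n by omega]
  refine le_trans ?_ (rpow_coeff_mul_lintegral_le hm hr hr1 hqk hkn hτB hfg (d := 1)
    le_rfl hB1 (by rw [hset, haar₂_I_prod_I, one_div, mul_inv]) z)
  rw [enorm_mul, hset]
  have hc := enorm_nat_coeff (M m q) (M m k) 1
  rw [Nat.cast_one, Nat.cast_one, div_one] at hc
  rw [hc]
  gcongr
  exact enorm_integral_le_lintegral_enorm _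

/-- The pointwise bound of `V_n f` by the maximal operators of the pieces. -/
theorem enorm_Vn_rpow_le (hm : ∀ k, 2 ≤ m k) (hB : ∀ k, m k ≤ B) (hr : 1 / 2 < r) (hr1 : r ≤ 1)
    (hfg : PowerDominates n r f g) (z : G m × G m) :
    ‖Vn n f z‖ₑ ^ r ≤ pieceMaximal m (amplitude B r) (rate r) g z := by
  have hr0 : 0 < r := by linarith
  have h : pieceMaximal m (amplitude B r) (rate r) g z =
      (∑' x, pieceTerm m B r g z (0, x)) + (∑' x, pieceTerm m B r g z (1, x)) +
        (∑' x, pieceTerm m B r g z (2, x)) + ∑' x, pieceTerm m B r g z (3, x) := by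
    rw [← Fin.sum_univ_four fun s => ∑' x, pieceTerm m B r g z (s, x),
      ← tsum_fintype (L := .unconditional _), ← ENNReal.tsum_prod']
    rfl
  rw [h]
  have hadd : ∀ a b : ℂ, ‖a + b‖ₑ ^ r ≤ ‖a‖ₑ ^ r + ‖b‖ₑ ^ r := fun a b =>
    (ENNReal.rpow_le_rpow (enorm_add_le a b) hr0.le).trans
      (ENNReal.rpow_add_le_add_rpow _ _ hr0.le hr1)
  refine (hadd _ _).trans (add_le_add ((hadd _ _).trans (add_le_add ((hadd _ _).trans
    (add_le_add ?_ ?_)) ?_)) ?_)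
  · exact enorm_V₁_rpow_le hm hB hr hr1 hfg z
  · exact enorm_V₂_rpow_le hm hB hr hr1 hfg z
  · exact enorm_V₃_rpow_le hm hB hr hr1 hfg z
  · exact enorm_V₄_rpow_le hm hB hr hr1 hfg z

end Pointwise

/-! ### From the pointwise bound to the norm inequalities. -/

section Bounds

variable {m : ℕ → ℕ}

theorem mem_iff_mem_of_measurableSet_cubes {n : ℕ} {s : Set (G m × G m)}
    (hs : MeasurableSet[MeasurableSpace.generateFrom (cubes m n)] s) (z : G m × G m)
    {v : G m × G m} (hv : v ∈ cubeSubgroup m n) : z - v ∈ s ↔ z ∈ s := by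
  induction s, hs using MeasurableSpace.generateFrom_induction with
  | hC t ht _ =>
    obtain ⟨y, rfl⟩ := ht
    refine and_congr (forall₂_congr fun i hi => ?_) (forall₂_congr fun i hi => ?_)
    · have h : (z - v).1 i = z.1 i := by simp [hv.1 i hi]
      rw [h]
    · have h : (z - v).2 i = z.2 i := by simp [hv.2 i hi]
      rw [h]
  | empty => exact Iff.rfl
  | compl t _ ih => exact not_congr ih
  | iUnion t _ ih => simp only [Set.mem_iUnion, ih]

/-- For r = 1 the measure factor is 1, so a pointwise majorant is enough and f need not be constant
on cubes. -/
theorem powerDominates_one {n : ℕ} {f : G m × G m → ℂ} {g : G m × G m → ℝ≥0∞}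
    (hfg : ∀ z, ‖f z‖ₑ ≤ g z) : PowerDominates n 1 f g := by
  intro S _ _ z
  rw [ENNReal.rpow_one, sub_self, ENNReal.rpow_zero, one_mul]
  exact lintegral_mono fun w => hfg _

/-- Turns an a.e. measurable function into a measurable majorant valid at every point, as the
pointwise bounds require: take a measurable version and put ∞ on a measurable null set. -/
theorem exists_measurable_ge_lintegral_eq {X : Type*} [MeasurableSpace X] {μ : Measure X}
    {h : X → ℝ≥0∞} (hh : AEMeasurable h μ) :
    ∃ g : X → ℝ≥0∞, Measurable g ∧ (∀ z, h z ≤ g z) ∧ ∫⁻ z, g z ∂μ = ∫⁻ z, h z ∂μ := by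
  set N := toMeasurable μ {z | h z ≠ hh.mk h z} with hN
  have hN0 : μ N = 0 := by
    rw [hN, measure_toMeasurable]
    exact hh.ae_eq_mk
  refine ⟨fun z => hh.mk h z + N.indicator (fun _ => ∞) z,
    hh.measurable_mk.add (measurable_const.indicator (measurableSet_toMeasurable _ _)),
    fun z => ?_, ?_⟩
  · by_cases hz : z ∈ N
    · simp [hz]
    · have h1 : h z = hh.mk h z := by
        by_contra hne
        exact hz (subset_toMeasurable _ _ hne)
      rw [h1]
      exact le_self_add
  · rw [lintegral_add_left hh.measurable_mk,
      lintegral_indicator (measurableSet_toMeasurable _ _), setLIntegral_const, hN0, mul_zero,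
      add_zero]
    exact (lintegral_congr_ae hh.ae_eq_mk).symm

variable [∀ k, NeZero (m k)]

/-- Measurability with respect to F_n forces f to be constant on the cosets of I_n × I_n, so
`lintegral_rpow_le_of_const_on_cosets` applies. -/
theorem powerDominates_of_adapted {n : ℕ} {r : ℝ} (hr0 : 0 < r) (hr1 : r ≤ 1)
    {f : G m × G m → ℂ} (hf : StronglyMeasurable[cubeFiltration m n] f)
    {g : G m × G m → ℝ≥0∞} (hfg : ∀ z, ‖f z‖ₑ ^ r ≤ g z) : PowerDominates n r f g := by
  intro S hS hSU z
  have hconst : ∀ z, ∀ v ∈ cubeSubgroup m n, ‖f (z - v)‖ₑ = ‖f z‖ₑ := by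
    intro z v hv
    have h : MeasurableSet[cubeFiltration m n] (f ⁻¹' {f z}) :=
      hf.measurable (measurableSet_singleton _)
    have h2 : f (z - v) = f z := (mem_iff_mem_of_measurableSet_cubes h z hv).2 rfl
    rw [h2]
  refine (lintegral_rpow_le_of_const_on_cosets (measurableSet_cubeSubgroup n)
    (haar₂_cubeSubgroup_ne_zero n) (h := fun z => ‖f z‖ₑ) hconst hS hSU hr0 hr1 z).trans ?_
  gcongr
  exact hfg _

theorem eLpNorm_martingaleV_le {B : ℕ} (hm : ∀ k, 2 ≤ m k) (hB : ∀ k, m k ≤ B) {p r : ℝ}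
    (hr : 1 / 2 < r) (hr1 : r ≤ 1) (hrp : r < p) {f : ℕ → G m × G m → ℂ}
    (hf : ∀ n, StronglyMeasurable[cubeFiltration m n] (f n)) :
    eLpNorm (martingaleV f) (ENNReal.ofReal p) (haar₂ m) ≤
      strongConst B (amplitude B r) (rate r) (p / r) ^ (1 / p) * hardyNorm p f := by
  have hr0 : 0 < r := by linarith
  have hp0 : 0 < p := hr0.trans hrp
  have hmax : Measurable (maximalFunction f) :=
    Measurable.iSup fun n => ((hf n).mono ((cubeFiltration m).le n)).measurable.enorm
  -- One g dominates |f^{(n)}|^r for all n simultaneously, so the supremum over n costs nothing; and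
  -- the L^{p/r} norm of g is a power of the Hardy norm.
  set g : G m × G m → ℝ≥0∞ := fun z => maximalFunction f z ^ r with hg
  have hpoint : ∀ z, martingaleV f z ^ p ≤
      pieceMaximal m (amplitude B r) (rate r) g z ^ (p / r) := by
    intro z
    have h1 : martingaleV f z ^ r ≤ pieceMaximal m (amplitude B r) (rate r) g z := by
      rw [← ENNReal.le_rpow_inv_iff hr0]
      refine iSup_le fun n => ?_
      rw [ENNReal.le_rpow_inv_iff hr0]
      refine enorm_Vn_rpow_le hm hB hr hr1 (powerDominates_of_adapted hr0 hr1 (hf n) fun y => ?_) z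
      exact ENNReal.rpow_le_rpow (le_iSup (fun n => ‖f n y‖ₑ) n) hr0.le
    calc martingaleV f z ^ p = (martingaleV f z ^ r) ^ (p / r) := by
          rw [← ENNReal.rpow_mul, mul_div_cancel₀ _ hr0.ne']
      _ ≤ _ := ENNReal.rpow_le_rpow h1 (by positivity)
  have hgp : ∀ z, g z ^ (p / r) = maximalFunction f z ^ p := fun z => by
    rw [hg, ← ENNReal.rpow_mul, mul_div_cancel₀ _ hr0.ne']
  have hlp : ∀ h : G m × G m → ℝ≥0∞, eLpNorm h (ENNReal.ofReal p) (haar₂ m) =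
      (∫⁻ z, h z ^ p ∂(haar₂ m)) ^ (1 / p) := fun h => by
    rw [eLpNorm_eq_lintegral_rpow_enorm_toReal (ENNReal.ofReal_pos.2 hp0).ne'
      ENNReal.ofReal_ne_top, ENNReal.toReal_ofReal hp0.le]
    rfl
  rw [hardyNorm, hlp, hlp, ← ENNReal.mul_rpow_of_nonneg _ _ (by positivity)]
  refine ENNReal.rpow_le_rpow ?_ (by positivity)
  calc ∫⁻ z, martingaleV f z ^ p ∂(haar₂ m)
      ≤ ∫⁻ z, pieceMaximal m (amplitude B r) (rate r) g z ^ (p / r) ∂(haar₂ m) :=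
        lintegral_mono hpoint
    _ ≤ strongConst B (amplitude B r) (rate r) (p / r) * ∫⁻ z, g z ^ (p / r) ∂(haar₂ m) :=
        lintegral_pieceMaximal_rpow_le hB (amplitude_ne_zero B r) (rate_ne_zero r)
          (rate_lt_one hr) ((one_lt_div hr0).2 hrp) (hmax.pow_const r)
    _ = _ := by simp_rw [hgp]

theorem mul_measure_V_gt_le {B : ℕ} (hm : ∀ k, 2 ≤ m k) (hB : ∀ k, m k ≤ B)
    {f : G m × G m → ℂ} (hf : Integrable f (haar₂ m)) (a : ℝ≥0∞) :
    a * haar₂ m {z | a < V f z} ≤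
      weakConst B (amplitude B 1) (rate 1) * eLpNorm f 1 (haar₂ m) := by
  obtain ⟨g, hgm, hfg, hint⟩ := exists_measurable_ge_lintegral_eq hf.aestronglyMeasurable.enorm
  rw [eLpNorm_one_eq_lintegral_enorm, ← hint]
  refine le_trans ?_ (mul_measure_pieceMaximal_gt_le hB (amplitude_ne_zero B 1) (rate_ne_zero 1)
    (rate_lt_one (by norm_num)) hgm a)
  refine mul_le_mul' le_rfl (measure_mono fun z hz => ?_)
  refine (Set.mem_ofPred_eq ▸ hz : _ < _).trans_le (iSup_le fun n => ?_)
  have h := enorm_Vn_rpow_le hm hB (by norm_num) le_rfl (powerDominates_one (n := n) hfg) z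
  rwa [ENNReal.rpow_one] at h

end Bounds

end Vilenkin

/-! ### The two inequalities, with constants depending only on B and p. -/

theorem theorem2 (B : ℕ) :
    (∀ p : ℝ, 1 / 2 < p → ∃ c : ℝ≥0, ∀ m : ℕ → ℕ, (∀ k, 2 ≤ m k ∧ m k ≤ B) →
      ∀ f : ℕ → Vilenkin.G m × Vilenkin.G m → ℂ, Vilenkin.MemHardy p f →
        eLpNorm (Vilenkin.martingaleV f) (ENNReal.ofReal p) (Vilenkin.haar₂ m)
          ≤ (c : ℝ≥0∞) * Vilenkin.hardyNorm p f) ∧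
    (∃ c : ℝ≥0, ∀ m : ℕ → ℕ, (∀ k, 2 ≤ m k ∧ m k ≤ B) →
      ∀ f : Vilenkin.G m × Vilenkin.G m → ℂ, Integrable f (Vilenkin.haar₂ m) →
        (⨆ lam : ℝ≥0, (lam : ℝ≥0∞) *
            Vilenkin.haar₂ m {z | (lam : ℝ≥0∞) < Vilenkin.V f z})
          ≤ (c : ℝ≥0∞) * eLpNorm f 1 (Vilenkin.haar₂ m)) := by
  constructor
  · intro p hp
    -- r > 1/2 gives decay of the coefficients, r ≤ 1 subadditivity of the r-th power, and r < p an
    -- exponent p / r > 1 for interpolation.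
    obtain ⟨r, hr, hr1, hrp⟩ : ∃ r : ℝ, 1 / 2 < r ∧ r ≤ 1 ∧ r < p := by
      obtain ⟨r, hr, hr'⟩ := exists_between (lt_min hp (by norm_num : (1 / 2 : ℝ) < 1))
      exact ⟨r, hr, (hr'.trans_le (min_le_right _ _)).le, hr'.trans_le (min_le_left _ _)⟩
    have hr0 : 0 < r := by linarith
    have hp0 : 0 < p := by linarith
    have hfin : Vilenkin.strongConst B (Vilenkin.amplitude B r) (Vilenkin.rate r) (p / r) ^
        (1 / p) ≠ ∞ :=
      ENNReal.rpow_ne_top_of_nonneg (by positivity) (Vilenkin.strongConst_ne_top B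
        (Vilenkin.amplitude_ne_zero B r) (Vilenkin.rate_lt_one hr) ((one_lt_div hr0).2 hrp))
    refine ⟨(Vilenkin.strongConst B (Vilenkin.amplitude B r) (Vilenkin.rate r) (p / r) ^
      (1 / p)).toNNReal, fun m hm f hf => ?_⟩
    have : ∀ k, NeZero (m k) := fun k => ⟨by have := (hm k).1; omega⟩
    rw [ENNReal.coe_toNNReal hfin]
    exact Vilenkin.eLpNorm_martingaleV_le (fun k => (hm k).1) (fun k => (hm k).2) hr hr1 hrp
      hf.1.1
  · refine ⟨(Vilenkin.weakConst B (Vilenkin.amplitude B 1) (Vilenkin.rate 1)).toNNReal,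
      fun m hm f hf => iSup_le fun a => ?_⟩
    have : ∀ k, NeZero (m k) := fun k => ⟨by have := (hm k).1; omega⟩
    rw [ENNReal.coe_toNNReal
      (Vilenkin.weakConst_ne_top B _ (Vilenkin.rate_lt_one (by norm_num)))]
    exact Vilenkin.mul_measure_V_gt_le (fun k => (hm k).1) (fun k => (hm k).2) hf a
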